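/- Let $G$ be a compact (Hausdorff) group acting on a unital C*-algebra $A$ by *-automorphisms $\alpha_g$ such that $(g,x)\mapsto\alpha_g(x)$ is continuous on $G\times A$. All representations of $G$ on Hilbert spaces are strongly continuous, all Hilbert spaces are complex, $H\otimes K$ is the Hilbert space tensor product, and $L^2(G)$ is taken with respect to the normalized Haar measure, with $(\lambda_g f)(x)=f(g^{-1}x)$ and $(r_g f)(x)=f(xg)$. A faithful covariant representation $(\pi,u)$ of $(A,G,\alpha)$ on a Hilbert space $H_A$ is an injective unital *-homomorphism $\pi:A\to B(H_A)$ together with a unitary representation $u$ of $G$ on $H_A$ with $u_g\pi(a)u_g^*=\pi(\alpha_g(a))$ for all $g\in G$, $a\in A$. For such $\pi$ and Hilbert spaces $K,L$ let $A\otimes\mathcal K(K,L)\subseteq B(H_A\otimes K,H_A\otimes L)$ be the operator norm closed linear span of all $\pi(a)\otimes T$ with $a\in A$ and $T:K\to L$ compact. The system $(A,G,\alpha)$ is called free if the map $\Phi:A\otimes_{\mathrm{alg}}A\to C(G,A)$, $\Phi(x\otimes y)(g)=x\,\alpha_g(y)$, has dense range for the supremum norm. The following statements are equivalent: (a) $(A,G,\alpha)$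 is free. (b) There is a unitary representation $\mu$ of $G$ on a Hilbert space $H$ with finite-dimensional multiplicity spaces (for every irreducible unitary representation $\sigma$ of $G$, the space of bounded operators intertwining $\sigma$ and $\mu$ is finite-dimensional) such that, for every faithful covariant representation $(\pi,u)$ of $(A,G,\alpha)$ on a Hilbert space $H_A$, there is an isometry $s:H_A\otimes L^2(G)\to H_A\otimes H$ satisfying $$s\,\bigl(A\otimes\mathcal K(L^2(G))\bigr)\subseteq A\otimes\mathcal K(L^2(G),H),$$ $$(u_g\otimes 1)\,s=s\,(u_g\otimes r_g)\quad\text{for all }g\in G,$$ $$(1\otimes\mu_g)\,s=s\,(1\otimes\lambda_g)\quad\text{for all }g\in G.$$ -/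

import Mathlib

open scoped TensorProduct

universe u v w

noncomputable section

namespace FreeAction

/-! ### C*-dynamical systems and freeness -/

/-- A C*-dynamical system `(A, G, α)`: an action of the topological group `G` on the unital
C*-algebra `A` by *-automorphisms such that `(g, x) ↦ α_g(x)` is jointly continuous. -/
structure CStarDynSystem (A : Type*) (G : Type*) [CStarAlgebra A] [Group G]
    [TopologicalSpace G] where
  /-- the action by *-automorphisms -/
  act : G →* (A ≃⋆ₐ[ℂ] A)
  /-- joint continuity -/
  continuous_act : Continuous fun p : G × A => act p.1 p.2

namespace CStarDynSystem

variable {A : Type*} {G : Type*} [CStarAlgebra A] [Group G] [TopologicalSpace G]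

theorem continuous_orbit (α : CStarDynSystem A G) (y : A) : Continuous fun g : G => α.act g y :=
  α.continuous_act.comp (by fun_prop : Continuous fun g : G => (g, y))

/-- For `x, y ∈ A` the continuous function `g ↦ x α_g(y)`. -/
def ellwoodFun (α : CStarDynSystem A G) (x y : A) : C(G, A) where
  toFun g := x * α.act g y
  continuous_toFun := continuous_const.mul (α.continuous_orbit y)

/-- The Ellwood map `Φ : A ⊗_alg A → C(G, A)`, `Φ(x ⊗ y)(g) = x α_g(y)`. -/
def ellwoodMap (α : CStarDynSystem A G) : A ⊗[ℂ] A →ₗ[ℂ] C(G, A) :=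
  TensorProduct.lift <| LinearMap.mk₂ ℂ α.ellwoodFun
    (fun x x' y => by ext g; simp [ellwoodFun, add_mul])
    (fun c x y => by ext g; simp [ellwoodFun])
    (fun x y y' => by ext g; simp [ellwoodFun, mul_add])
    (fun c x y => by ext g; simp [ellwoodFun])

/-- The system is free if the Ellwood map has dense range; for compact `G` the topology of
`C(G, A)` is that of the C*-norm `‖f‖ = sup_g ‖f(g)‖`. -/
def IsFree (α : CStarDynSystem A G) : Prop :=
  DenseRange α.ellwoodMap

end CStarDynSystem

/-! ### Hilbert space tensor products -/

/-- The Hilbert space tensor product: the completion of the algebraic tensor product for the inner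
product `⟪a ⊗ b, c ⊗ d⟫ = ⟪a, c⟫ ⟪b, d⟫`. -/
abbrev HTensor (E F : Type*) [NormedAddCommGroup E] [InnerProductSpace ℂ E]
    [NormedAddCommGroup F] [InnerProductSpace ℂ F] : Type _ :=
  UniformSpace.Completion (E ⊗[ℂ] F)

section TensorOperators

variable {E F K L : Type*} [NormedAddCommGroup E] [InnerProductSpace ℂ E]
  [NormedAddCommGroup F] [InnerProductSpace ℂ F] [NormedAddCommGroup K] [InnerProductSpace ℂ K]
  [NormedAddCommGroup L] [InnerProductSpace ℂ L]

/-- The bounded operator `S ⊗ T` on Hilbert space tensor products. -/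
def tensorOp (S : E →L[ℂ] F) (T : K →L[ℂ] L) : HTensor E K →L[ℂ] HTensor F L :=
  (TensorProduct.mapL S T).completion

theorem tensorOp_tmul (S : E →L[ℂ] F) (T : K →L[ℂ] L) (x : E) (y : K) :
    tensorOp S T ((x ⊗ₜ[ℂ] y : E ⊗[ℂ] K) : HTensor E K) =
      ((S x ⊗ₜ[ℂ] T y : F ⊗[ℂ] L) : HTensor F L) := by
  simp [tensorOp]

end TensorOperators

/-! ### Unitary representations -/

/-- A (strongly continuous) unitary representation of `G` on the Hilbert space `H`. -/
structure UnitaryRep (G : Type*) [Group G] [TopologicalSpace G] (H : Type*)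
    [NormedAddCommGroup H] [InnerProductSpace ℂ H] [CompleteSpace H] where
  /-- the homomorphism into the unitary group -/
  toHom : G →* unitary (H →L[ℂ] H)
  /-- strong continuity -/
  continuous_apply : ∀ ξ : H, Continuous fun g => (toHom g : H →L[ℂ] H) ξ

namespace UnitaryRep

variable {G : Type*} [Group G] [TopologicalSpace G]
variable {H : Type*} [NormedAddCommGroup H] [InnerProductSpace ℂ H] [CompleteSpace H]
variable {V : Type*} [NormedAddCommGroup V] [InnerProductSpace ℂ V] [CompleteSpace V]

/-- The unitary operator `u_g` as a bounded operator. -/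
def op (u : UnitaryRep G H) (g : G) : H →L[ℂ] H := (u.toHom g : H →L[ℂ] H)

/-- Irreducibility: the space is nonzero and has no invariant closed subspaces besides `0` and
itself. -/
def IsIrreducible (σ : UnitaryRep G V) : Prop :=
  Nontrivial V ∧ ∀ W : Submodule ℂ V, IsClosed (W : Set V) →
    (∀ g : G, ∀ v ∈ W, σ.op g v ∈ W) → W = ⊥ ∨ W = ⊤

/-- The multiplicity space of `σ` in `μ`: the intertwining operators from `σ` to `μ`. -/
def multiplicitySpace (σ : UnitaryRep G V) (μ : UnitaryRep G H) : Submodule ℂ (V →L[ℂ] H) where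
  carrier := {T | ∀ g : G, T ∘L σ.op g = μ.op g ∘L T}
  zero_mem' g := by simp
  add_mem' hS hT g := by
    rw [ContinuousLinearMap.add_comp, ContinuousLinearMap.comp_add, hS g, hT g]
  smul_mem' c T hT g := by
    rw [ContinuousLinearMap.smul_comp, ContinuousLinearMap.comp_smul, hT g]

/-- `μ` has finite-dimensional multiplicity spaces. For compact `G` every irreducible unitary
representation is unitarily equivalent to one on some `ℂⁿ`, so these are enough to test. -/
def HasFiniteMultiplicities (μ : UnitaryRep G H) : Prop :=
  ∀ (n : ℕ) (σ : UnitaryRep G (EuclideanSpace ℂ (Fin n))), σ.IsIrreducible →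
    FiniteDimensional ℂ (multiplicitySpace σ μ)

end UnitaryRep

/-! ### The regular representations -/

section Regular

variable (G : Type*) [Group G] [TopologicalSpace G] [IsTopologicalGroup G] [CompactSpace G]
  [MeasurableSpace G] [BorelSpace G]

/-- The normalized Haar measure of the compact group `G`. -/
def haarProb : MeasureTheory.Measure G :=
  MeasureTheory.Measure.haarMeasure ⊤

instance : MeasureTheory.Measure.IsHaarMeasure (haarProb G) :=
  MeasureTheory.Measure.isHaarMeasure_haarMeasure _

instance : MeasureTheory.IsProbabilityMeasure (haarProb G) :=
  ⟨MeasureTheory.Measure.haarMeasure_self (K₀ := (⊤ : TopologicalSpace.PositiveCompacts G))⟩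

instance : MeasureTheory.Measure.Regular (haarProb G) :=
  MeasureTheory.Measure.regular_haarMeasure

/-- The Haar measure of a compact group is also right invariant. -/
instance : MeasureTheory.Measure.IsMulRightInvariant (haarProb G) where
  map_mul_right_eq_self g := by
    have h1 : MeasureTheory.IsProbabilityMeasure ((haarProb G).map (· * g)) :=
      MeasureTheory.Measure.isProbabilityMeasure_map (by fun_prop)
    have h2 : MeasureTheory.Measure.IsHaarMeasure ((haarProb G).map (· * g)) := inferInstance
    exact MeasureTheory.Measure.isHaarMeasure_eq_of_isProbabilityMeasure _ _

/-- The Hilbert space `L²(G)`. -/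
abbrev L2 : Type _ := MeasureTheory.Lp ℂ 2 (haarProb G)

variable {G}

/-- The left translation `(λ_g f)(x) = f(g⁻¹ x)` on `L²(G)`. -/
def leftReg (g : G) : L2 G →L[ℂ] L2 G :=
  (MeasureTheory.Lp.compMeasurePreservingₗᵢ ℂ (g⁻¹ * ·)
    (MeasureTheory.measurePreserving_mul_left (haarProb G) g⁻¹)).toContinuousLinearMap

/-- The right translation `(r_g f)(x) = f(x g)` on `L²(G)`. -/
def rightReg (g : G) : L2 G →L[ℂ] L2 G :=
  (MeasureTheory.Lp.compMeasurePreservingₗᵢ ℂ (· * g)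
    (MeasureTheory.measurePreserving_mul_right (haarProb G) g)).toContinuousLinearMap

end Regular

/-! ### Covariant representations and the multiplier condition -/

section Covariant

variable {A : Type*} {G : Type*} [CStarAlgebra A] [Group G] [TopologicalSpace G]
variable {HA : Type*} [NormedAddCommGroup HA] [InnerProductSpace ℂ HA] [CompleteSpace HA]

/-- `(π, u)` is a faithful covariant representation of `(A, G, α)` on `HA`: the (unital)
*-representation `π` is injective and `u_g π(a) u_g* = π(α_g(a))`. -/
def IsFaithfulCovariantRep (α : CStarDynSystem A G) (π : A →⋆ₐ[ℂ] (HA →L[ℂ] HA))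
    (u : UnitaryRep G HA) : Prop :=
  Function.Injective π ∧
    ∀ (g : G) (a : A), u.op g ∘L π a ∘L star (u.op g) = π (α.act g a)

/-- `A ⊗ 𝒦(K, L)`: the operator norm closure of the linear span of all `π(a) ⊗ T`, with `a ∈ A` and
`T : K → L` compact, in the bounded operators `HA ⊗ K → HA ⊗ L`. -/
def tensorCompact (π : A →⋆ₐ[ℂ] (HA →L[ℂ] HA)) (K L : Type*)
    [NormedAddCommGroup K] [InnerProductSpace ℂ K] [NormedAddCommGroup L] [InnerProductSpace ℂ L] :
    Submodule ℂ (HTensor HA K →L[ℂ] HTensor HA L) :=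
  (Submodule.span ℂ {X | ∃ (a : A) (T : K →L[ℂ] L), IsCompactOperator T ∧
    X = tensorOp (π a) T}).topologicalClosure

end Covariant

end FreeAction

end

/-!
# Freeness of actions of compact groups on C*-algebras

*From freeness to the isometry.* By the Peter-Weyl theorem `L²(G)` is the orthogonal sum of
finite-dimensional subspaces `W` ("blocks") that are invariant under left and right translations
(`exists_orthogonal_blocks`). It suffices to construct, for every `W`, a partial isometry
`s_W : HA ⊗ L²(G) → HA ⊗ H` in `A ⊗ 𝒦` with the required equivariance, with initial projection
`1 ⊗ P_W`, and such that the `s_W` have orthogonal ranges; these glue to `s`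
(`exists_isometry_of_orthogonal`), and `s` maps `A ⊗ 𝒦` into `A ⊗ 𝒦` because it does so after
composition with every `1 ⊗ P_W` (`comp_mem_compactTensor_of_dense`).

For a block `W`, freeness gives finitely many `x_k`, `y_k` in `A` such that `g ↦ ∑ x_k α_g(y_k)` is
uniformly close to `m(g) 1`, where `m` is a continuous approximate identity on `G` which almost
fixes the vectors of `W`. Reserve in `H` one copy of `W` for each `k`, with inclusion `ι_k`, and put
`S = ∑ₖ ∫ π(α_g(y_k)) ⊗ ι_k P_W r_g⁻¹ dg`. Invariance of the Haar measure makes `S` equivariant, and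
the operator `∑ π(x_k) ⊗ ι_k*` maps `S` to `∫ π(∑ x_k α_g(y_k)) ⊗ P_W r_g⁻¹ dg`, which is close to
`1 ⊗ P_W`. So `S` is bounded below on `HA ⊗ W`, and `s_W` is the partial isometry in its polar
decomposition (`exists_polar`, `exists_block_isometry`); it stays in `A ⊗ 𝒦` by functional calculus
(`comp_mem_of_mem_elemental`). The representation on `H` is the sum of the left translations on
these copies. It has finite multiplicities: an irreducible representation has a convolution operator
acting as a nonzero scalar `c`, the eigenspace for `c` of the same convolution operator on `L²(G)`
is finite-dimensional because convolution operators are compact, so it meets only finitely many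
blocks (`hasFiniteMultiplicities_directSum_blocks`).

*From the isometry to freeness.* A faithful covariant representation `(π, u)` exists: take the GNS
representations of all invariant positive functionals (`exists_isFaithfulCovariantRep`). For `f`,
`f'` in `L²(G)` the operators `V_f = s (· ⊗ f)` satisfy `V_f* (u_g ⊗ 1) V_f' u_g* = ⟪f, r_g f'⟫ 1`.
On the other hand `V_f` and `V_f'` are norm limits of sums of operators `π(a) · ⊗ h`, and for such
operators the left side is `⟪h, h'⟫ π(a* α_g(b))`, which is the image of an element in the range of
the Ellwood map. Hence the closure of that range contains the matrix coefficients of the right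
regular representation. It is stable under left multiplication by `A`, and convolving with
approximate identities shows that it is all of `C(G, A)` (`isFree_of_isometry`).
-/

noncomputable section

namespace FreeAction

open MeasureTheory Topology InnerProductSpace
open ContinuousLinearMap (adjoint)

/-! ### Haar integrals of continuous functions and approximate identities -/

section Haar

variable {G : Type*} [Group G] [TopologicalSpace G] [IsTopologicalGroup G] [CompactSpace G]
  [MeasurableSpace G] [BorelSpace G]

instance : (haarProb G).IsInvInvariant where
  inv_eq_self := by
    have h1 : IsProbabilityMeasure (haarProb G).inv :=
      Measure.isProbabilityMeasure_map measurable_inv.aemeasurable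
    have h2 : (haarProb G).inv.IsHaarMeasure :=
      { toIsMulLeftInvariant := inferInstance
        toIsFiniteMeasureOnCompacts := inferInstance
        toIsOpenPosMeasure := (Homeomorph.inv G).continuous.isOpenPosMeasure_map
          (Homeomorph.inv G).surjective }
    exact Measure.isHaarMeasure_eq_of_isProbabilityMeasure _ _

theorem integrable_haarProb {E : Type*} [NormedAddCommGroup E] {f : G → E} (hf : Continuous f) :
    Integrable f (haarProb G) :=
  hf.integrable_of_hasCompactSupport (.of_compactSpace f)

theorem norm_integral_haarProb_le {E : Type*} [NormedAddCommGroup E] [NormedSpace ℝ E]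
    {f : G → E} {C : ℝ} (h : ∀ g, ‖f g‖ ≤ C) : ‖∫ g, f g ∂haarProb G‖ ≤ C := by
  simpa using norm_integral_le_of_norm_le_const (μ := haarProb G) (Filter.Eventually.of_forall h)

theorem integral_haarProb_mem {E : Type*} [NormedAddCommGroup E] [NormedSpace ℂ E]
    [CompleteSpace E] {S : Submodule ℂ E} (hS : IsClosed (S : Set E)) {f : G → E}
    (hf : Continuous f) (h : ∀ g, f g ∈ S) : ∫ g, f g ∂haarProb G ∈ S :=
  (S.restrictScalars ℝ).convex.integral_mem hS (Filter.Eventually.of_forall h)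
    (integrable_haarProb hf)

variable (G) in
/-- A mollifier: a nonnegative continuous function of integral one which is invariant under
conjugation and inversion. -/
structure Mollifier where
  /-- the underlying function -/
  toFun : C(G, ℝ)
  nonneg : ∀ g, 0 ≤ toFun g
  conj_eq : ∀ g x, toFun (g * x * g⁻¹) = toFun x
  inv_eq : ∀ x, toFun x⁻¹ = toFun x
  integral_eq : ∫ x, toFun x ∂haarProb G = 1

namespace Mollifier

instance : CoeFun (Mollifier G) fun _ => G → ℝ := ⟨fun h => h.toFun⟩

theorem continuous (h : Mollifier G) : Continuous h := h.toFun.continuous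

theorem continuous_smul {E : Type*} [NormedAddCommGroup E] [NormedSpace ℝ E] (h : Mollifier G)
    {f : G → E} (hf : Continuous f) : Continuous fun g => h g • f g :=
  h.continuous.smul hf

theorem mul_comm_eq (h : Mollifier G) (x y : G) : h (x * y) = h (y * x) := by
  rw [← h.conj_eq y (x * y)]; congr 1; group

theorem norm_integral_smul_le {E : Type*} [NormedAddCommGroup E] [NormedSpace ℝ E]
    (h : Mollifier G) {f : G → E} {C : ℝ} (hf : ∀ g, ‖f g‖ ≤ C) :
    ‖∫ g, h g • f g ∂haarProb G‖ ≤ C := by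
  calc ‖∫ g, h g • f g ∂haarProb G‖ ≤ ∫ g, h g * C ∂haarProb G := by
        refine norm_integral_le_of_norm_le
          (integrable_haarProb (h.continuous.mul continuous_const)) (.of_forall fun g => ?_)
        rw [norm_smul, Real.norm_of_nonneg (h.nonneg g)]
        exact mul_le_mul_of_nonneg_left (hf g) (h.nonneg g)
    _ = C := by rw [integral_mul_const, h.integral_eq, one_mul]

end Mollifier

/-- Mollifiers concentrate at the identity. The mollifier is a normalization of
`x ↦ (ε - d(x))⁺`, where `d(x)` is the largest distance of `F 1` to the values of `F` on the
conjugates of `x` and of `x⁻¹`. -/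
theorem exists_mollifier {E : Type*} [NormedAddCommGroup E] [NormedSpace ℝ E] [CompleteSpace E]
    {F : G → E} (hF : Continuous F) {ε : ℝ} (hε : 0 < ε) :
    ∃ h : Mollifier G, ‖∫ g, h g • F g ∂haarProb G - F 1‖ ≤ ε := by
  let D : C(G, C(G, E)) := ContinuousMap.curry
    ⟨fun p : G × G => F (p.2 * p.1 * p.2⁻¹) - F 1, by fun_prop⟩
  have hD (x g : G) : D x g = F (g * x * g⁻¹) - F 1 := rfl
  have hDconj (g x : G) : ‖D (g * x * g⁻¹)‖ = ‖D x‖ := by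
    have key (g x : G) : ‖D (g * x * g⁻¹)‖ ≤ ‖D x‖ := by
      refine (ContinuousMap.norm_le _ (norm_nonneg _)).2 fun k => ?_
      have : D (g * x * g⁻¹) k = D x (k * g) := by
        rw [hD, hD]; congr 2; group
      rw [this]; exact (D x).norm_coe_le_norm _
    refine le_antisymm (key g x) ?_
    have := key g⁻¹ (g * x * g⁻¹)
    have e : g⁻¹ * (g * x * g⁻¹) * g⁻¹⁻¹ = x := by group
    rwa [e] at this
  let d : G → ℝ := fun x => max ‖D x‖ ‖D x⁻¹‖
  have hd : Continuous d := by fun_prop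
  let k : G → ℝ := fun x => max 0 (ε - d x)
  have hk : Continuous k := by fun_prop
  have hk0 : 0 ≤ k := fun x => le_max_left _ _
  have hd1 : d 1 = 0 := by
    have : D 1 = 0 := by ext g; simp [hD]
    simp [d, this]
  have hk1 : k 1 ≠ 0 := by simp [k, hd1, hε.le, hε.ne']
  set c := ∫ x, k x ∂haarProb G with hc
  have hcpos : 0 < c :=
    hk.integral_pos_of_hasCompactSupport_nonneg_nonzero (.of_compactSpace k) hk0 hk1
  let h : Mollifier G :=
    { toFun := ⟨fun x => c⁻¹ * k x, by fun_prop⟩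
      nonneg := fun x => mul_nonneg (inv_nonneg.2 hcpos.le) (hk0 x)
      conj_eq := fun g x => by
        have e : (g * x * g⁻¹)⁻¹ = g * x⁻¹ * g⁻¹ := by group
        simp only [ContinuousMap.coe_mk, k, d, e, hDconj]
      inv_eq := fun x => by simp [k, d, max_comm]
      integral_eq := by
        simp only [ContinuousMap.coe_mk]
        rw [integral_const_mul, ← hc, inv_mul_cancel₀ hcpos.ne'] }
  refine ⟨h, ?_⟩
  have hFle (x : G) (hx : k x ≠ 0) : ‖F x - F 1‖ ≤ ε := by
    have h1 : d x < ε := by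
      by_contra hcon
      exact hx (max_eq_left (by linarith))
    have h2 : ‖D x 1‖ ≤ d x := ((D x).norm_coe_le_norm 1).trans (le_max_left _ _)
    have h3 : D x 1 = F x - F 1 := by simp [hD]
    rw [← h3]; linarith
  have e1 : ∫ g, h g • F g ∂haarProb G - F 1 = ∫ g, h g • (F g - F 1) ∂haarProb G := by
    simp_rw [smul_sub]
    rw [integral_sub (integrable_haarProb (h.continuous_smul hF))
      (integrable_haarProb (h.continuous_smul continuous_const)), integral_smul_const,
      h.integral_eq, one_smul]
  rw [e1]
  calc ‖∫ g, h g • (F g - F 1) ∂haarProb G‖ ≤ ∫ g, h g * ε ∂haarProb G := by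
        refine norm_integral_le_of_norm_le
          (integrable_haarProb (h.continuous.mul continuous_const)) (.of_forall fun g => ?_)
        rw [norm_smul, Real.norm_of_nonneg (h.nonneg g)]
        by_cases hg : k g = 0
        · have : h g = 0 := by change c⁻¹ * k g = 0; rw [hg, mul_zero]
          simp [this]
        · exact mul_le_mul_of_nonneg_left (hFle g hg) (h.nonneg g)
    _ = ε := by rw [integral_mul_const, h.integral_eq, one_mul]

/-- A closed subspace of `C(G, E)` containing, for every mollifier `h` and every vector `v`, all
functions `x ↦ h(x⁻¹ y) v`, is everything: `F` is close to `x ↦ ∫ h(y) F(x y) dy`, which is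
an integral of functions of this form. -/
theorem eq_top_of_mollifier_smul_mem {E : Type*} [NormedAddCommGroup E] [NormedSpace ℂ E]
    [CompleteSpace E] {S : Submodule ℂ C(G, E)} (hS : IsClosed (S : Set C(G, E)))
    (h : ∀ (m : Mollifier G) (y : G) (v : E) (f : C(G, E)),
      (∀ x, f x = m (x⁻¹ * y) • v) → f ∈ S) : S = ⊤ := by
  rw [eq_top_iff]
  intro F _
  refine hS.closure_subset_iff.2 subset_rfl (Metric.mem_closure_iff.2 fun ε hε => ?_)
  let T : C(G, C(G, E)) := ContinuousMap.curry ⟨fun p : G × G => F (p.2 * p.1), by fun_prop⟩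
  have hT (y x : G) : T y x = F (x * y) := rfl
  obtain ⟨m, hm⟩ := exists_mollifier T.continuous (half_pos hε)
  let K : C(G, C(G, E)) := ContinuousMap.curry
    ⟨fun p : G × G => m (p.2⁻¹ * p.1) • F p.1, by have := m.continuous; fun_prop⟩
  have hK (y x : G) : K y x = m (x⁻¹ * y) • F y := rfl
  have e1 : ∫ y, m y • T y ∂haarProb G = ∫ y, K y ∂haarProb G := by
    ext x
    rw [ContinuousMap.integral_apply (integrable_haarProb (m.continuous_smul T.continuous)),
      ContinuousMap.integral_apply (integrable_haarProb K.continuous)]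
    rw [← integral_mul_left_eq_self (fun y => K y x) x]
    simp [hK, hT]
  have e2 : T 1 = F := by ext x; simp [hT]
  rw [e1, e2] at hm
  refine ⟨_, integral_haarProb_mem hS K.continuous fun y => h m y (F y) _ fun x => hK y x, ?_⟩
  rw [dist_comm, dist_eq_norm]
  exact hm.trans_lt (half_lt_self hε)

end Haar

/-! ### Operators on Hilbert space tensor products -/

section Tensor

variable {E F K L M N : Type*} [NormedAddCommGroup E] [InnerProductSpace ℂ E]
  [NormedAddCommGroup F] [InnerProductSpace ℂ F] [NormedAddCommGroup K] [InnerProductSpace ℂ K]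
  [NormedAddCommGroup L] [InnerProductSpace ℂ L] [NormedAddCommGroup M] [InnerProductSpace ℂ M]
  [NormedAddCommGroup N] [InnerProductSpace ℂ N]

variable (E K) in
/-- A type synonym of the Hilbert space tensor product `HTensor E K`. It is not reducible, so that
its topology and its module structure are only found through the normed structure and not through
those of completions; the two agree definitionally. -/
def HilbertTensor : Type _ := HTensor E K

instance : NormedAddCommGroup (HilbertTensor E K) :=
  inferInstanceAs (NormedAddCommGroup (HTensor E K))

instance : InnerProductSpace ℂ (HilbertTensor E K) :=
  inferInstanceAs (InnerProductSpace ℂ (HTensor E K))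

instance : CompleteSpace (HilbertTensor E K) :=
  inferInstanceAs (CompleteSpace (HTensor E K))

/-- The operator `tensorOp S T`, between the type synonyms. -/
def opTensor (S : E →L[ℂ] F) (T : K →L[ℂ] L) : HilbertTensor E K →L[ℂ] HilbertTensor F L :=
  tensorOp S T

/-- The elementary tensor `x ⊗ f`. -/
def elemTensor (f : K) (x : E) : HilbertTensor E K :=
  ((x ⊗ₜ[ℂ] f : E ⊗[ℂ] K) : HTensor E K)

variable (E) in
/-- The operator `x ↦ x ⊗ f` from `E` to `E ⊗ K`, depending linearly on `f`. -/
def tensorVec : K →L[ℂ] E →L[ℂ] HilbertTensor E K :=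
  LinearMap.mkContinuous₂
    (LinearMap.mk₂ ℂ (fun (f : K) (x : E) => elemTensor f x)
      (fun f f' x => by
        unfold elemTensor
        rw [TensorProduct.tmul_add, UniformSpace.Completion.coe_add]; rfl)
      (fun c f x => by
        unfold elemTensor
        rw [TensorProduct.tmul_smul, UniformSpace.Completion.coe_smul]; rfl)
      (fun f x x' => by
        unfold elemTensor
        rw [TensorProduct.add_tmul, UniformSpace.Completion.coe_add]; rfl)
      (fun c f x => by
        unfold elemTensor
        rw [← TensorProduct.smul_tmul', UniformSpace.Completion.coe_smul]; rfl))
    1 (fun f x => by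
      rw [LinearMap.mk₂_apply, one_mul]
      exact (UniformSpace.Completion.norm_coe _).le.trans
        (by rw [TensorProduct.norm_tmul, mul_comm]))

theorem inner_tensorVec (f g : K) (x y : E) :
    inner ℂ (tensorVec E f x) (tensorVec E g y) = inner ℂ x y * inner ℂ f g :=
  (UniformSpace.Completion.inner_coe _ _).trans (TensorProduct.inner_tmul ℂ x y f g)

@[simp]
theorem opTensor_tensorVec (S : E →L[ℂ] F) (T : K →L[ℂ] L) (f : K) (x : E) :
    opTensor S T (tensorVec E f x) = tensorVec F (T f) (S x) :=
  tensorOp_tmul S T x f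

theorem opTensor_comp_tensorVec (S : E →L[ℂ] F) (T : K →L[ℂ] L) (f : K) :
    opTensor S T ∘L tensorVec E f = tensorVec F (T f) ∘L S := by
  ext x; simp

theorem HilbertTensor.eq_top {S : Submodule ℂ (HilbertTensor E K)} (hS : IsClosed (S : Set (HilbertTensor E K)))
    (h : ∀ (f : K) (x : E), tensorVec E f x ∈ S) : S = ⊤ := by
  refine Submodule.eq_top_iff'.2 fun (z : HTensor E K) => ?_
  induction z using UniformSpace.Completion.induction_on with
  | hp => exact hS
  | ih z =>
    induction z using TensorProduct.induction_on with
    | zero => exact S.zero_mem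
    | tmul x f => exact h f x
    | add a b ha hb => rw [UniformSpace.Completion.coe_add]; exact S.add_mem ha hb

theorem HilbertTensor.clm_ext {X : Type*} [NormedAddCommGroup X] [NormedSpace ℂ X]
    {A B : HilbertTensor E K →L[ℂ] X} (h : ∀ (f : K) (x : E), A (tensorVec E f x) = B (tensorVec E f x)) :
    A = B := by
  have := HilbertTensor.eq_top (S := (A - B).ker) (A - B).isClosed_ker
    (fun f x => by simp [h f x])
  ext z
  have hz : z ∈ (A - B).ker := this ▸ Submodule.mem_top
  simpa [sub_eq_zero] using hz

theorem opTensor_comp (S : F →L[ℂ] M) (T : L →L[ℂ] N) (S' : E →L[ℂ] F) (T' : K →L[ℂ] L) :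
    opTensor S T ∘L opTensor S' T' = opTensor (S ∘L S') (T ∘L T') :=
  HilbertTensor.clm_ext fun f x => by simp

theorem opTensor_id :
    opTensor (ContinuousLinearMap.id ℂ E) (ContinuousLinearMap.id ℂ K) =
      ContinuousLinearMap.id ℂ (HilbertTensor E K) :=
  HilbertTensor.clm_ext fun f x => by simp

theorem norm_opTensor_le (S : E →L[ℂ] F) (T : K →L[ℂ] L) : ‖opTensor S T‖ ≤ ‖S‖ * ‖T‖ := by
  refine ContinuousLinearMap.opNorm_le_bound _ (by positivity) fun (z : HTensor E K) => ?_
  induction z using UniformSpace.Completion.induction_on with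
  | hp =>
    exact isClosed_le (opTensor S T).continuous.norm
      (continuous_const.mul (continuous_norm (E := HilbertTensor E K)))
  | ih z =>
    have h1 : opTensor S T (z : HTensor E K) =
        ((TensorProduct.mapL S T z : F ⊗[ℂ] L) : HTensor F L) :=
      ContinuousLinearMap.completion_apply_coe _ _
    rw [h1]
    refine (UniformSpace.Completion.norm_coe _).le.trans (le_of_le_of_eq
      ((TensorProduct.mapL S T).le_of_opNorm_le (TensorProduct.norm_mapL_le S T) z) ?_)
    exact congrArg _ (UniformSpace.Completion.norm_coe z).symm

theorem opTensor_add_left (S S' : E →L[ℂ] F) (T : K →L[ℂ] L) :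
    opTensor (S + S') T = opTensor S T + opTensor S' T :=
  HilbertTensor.clm_ext fun f x => by
    rw [add_apply]
    simp only [opTensor_tensorVec, add_apply, map_add]

theorem opTensor_add_right (S : E →L[ℂ] F) (T T' : K →L[ℂ] L) :
    opTensor S (T + T') = opTensor S T + opTensor S T' :=
  HilbertTensor.clm_ext fun f x => by
    rw [add_apply]
    simp only [opTensor_tensorVec, add_apply, map_add]

theorem opTensor_smul_left (c : ℂ) (S : E →L[ℂ] F) (T : K →L[ℂ] L) :
    opTensor (c • S) T = c • opTensor S T :=
  HilbertTensor.clm_ext fun f x => by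
    rw [smul_apply]
    simp only [opTensor_tensorVec, smul_apply, map_smul]

theorem opTensor_smul_right (c : ℂ) (S : E →L[ℂ] F) (T : K →L[ℂ] L) :
    opTensor S (c • T) = c • opTensor S T :=
  HilbertTensor.clm_ext fun f x => by
    rw [smul_apply]
    simp only [opTensor_tensorVec, smul_apply, map_smul]

variable (E F K L) in
/-- `S ⊗ T` as a bounded bilinear map in `S` and `T`. -/
def opTensorL : (E →L[ℂ] F) →L[ℂ] (K →L[ℂ] L) →L[ℂ] (HilbertTensor E K →L[ℂ] HilbertTensor F L) :=
  LinearMap.mkContinuous₂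
    (LinearMap.mk₂ ℂ opTensor opTensor_add_left opTensor_smul_left opTensor_add_right
      opTensor_smul_right)
    1 (fun S T => by rw [one_mul]; exact norm_opTensor_le S T)

theorem opTensorL_apply (S : E →L[ℂ] F) (T : K →L[ℂ] L) : opTensorL E F K L S T = opTensor S T :=
  rfl

theorem opTensor_zero_right (S : E →L[ℂ] F) : opTensor S (0 : K →L[ℂ] L) = 0 :=
  (opTensorL E F K L S).map_zero

theorem opTensor_sub_left (S S' : E →L[ℂ] F) (T : K →L[ℂ] L) :
    opTensor (S - S') T = opTensor S T - opTensor S' T :=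
  congr($((opTensorL E F K L).map_sub S S') T)

theorem opTensor_sub_right (S : E →L[ℂ] F) (T T' : K →L[ℂ] L) :
    opTensor S (T - T') = opTensor S T - opTensor S T' :=
  (opTensorL E F K L S).map_sub T T'

theorem opTensor_sum_left {ι : Type*} (s : Finset ι) (S : ι → E →L[ℂ] F) (T : K →L[ℂ] L) :
    opTensor (∑ i ∈ s, S i) T = ∑ i ∈ s, opTensor (S i) T := by
  rw [← opTensorL_apply, map_sum, sum_apply]
  rfl

theorem continuous_opTensor {X : Type*} [TopologicalSpace X] {S : X → E →L[ℂ] F}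
    {T : X → K →L[ℂ] L} (hS : Continuous S) (hT : Continuous T) :
    Continuous fun x => opTensor (S x) (T x) :=
  ((opTensorL E F K L).continuous.comp hS).clm_apply hT

theorem adjoint_opTensor [CompleteSpace E] [CompleteSpace F] [CompleteSpace K] [CompleteSpace L]
    (S : E →L[ℂ] F) (T : K →L[ℂ] L) :
    adjoint (opTensor S T) = opTensor (adjoint S) (adjoint T) := by
  refine HilbertTensor.clm_ext fun f x => ?_
  have h : innerSL ℂ (adjoint (opTensor S T) (tensorVec F f x)) =
      innerSL ℂ (opTensor (adjoint S) (adjoint T) (tensorVec F f x)) := by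
    refine HilbertTensor.clm_ext fun g y => ?_
    simp [ContinuousLinearMap.adjoint_inner_left, inner_tensorVec]
  exact innerSL_inj.1 h

theorem adjoint_tensorVec_tensorVec [CompleteSpace E] (f g : K) (x : E) :
    adjoint (tensorVec E f) (tensorVec E g x) = (inner ℂ f g : ℂ) • x := by
  refine ext_inner_left ℂ fun y => ?_
  rw [ContinuousLinearMap.adjoint_inner_right, inner_tensorVec, inner_smul_right, mul_comm]

end Tensor

/-! ### Compact operators are limits of finite rank operators -/

section Compact

variable {K L : Type*} [NormedAddCommGroup K] [InnerProductSpace ℂ K]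
  [NormedAddCommGroup L] [InnerProductSpace ℂ L]

theorem isCompactOperator_of_factor {V : Type*} [NormedAddCommGroup V] [NormedSpace ℂ V]
    [FiniteDimensional ℂ V] (S : V →L[ℂ] L) (T : K →L[ℂ] V) : IsCompactOperator (S ∘L T) := by
  have : ProperSpace V := FiniteDimensional.proper ℂ V
  have h : IsCompactOperator (ContinuousLinearMap.id ℂ V) :=
    isCompactOperator_id_iff_finiteDimensional (𝕜 := ℂ).2 inferInstance
  exact (h.comp_clm T).clm_comp S

theorem isCompactOperator_rankOne (v : L) (w : K) : IsCompactOperator (rankOne ℂ v w) := by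
  have : rankOne ℂ v w = ContinuousLinearMap.toSpanSingleton ℂ v ∘L innerSL ℂ w := by
    ext; simp
  rw [this]
  exact isCompactOperator_of_factor _ _

/-- A compact operator into a Hilbert space is a norm limit of finite rank operators: project onto
the span of a finite `ε`-net of the image of the unit ball. -/
theorem IsCompactOperator.mem_closure_span_rankOne [CompleteSpace K] [CompleteSpace L]
    {T : K →L[ℂ] L} (hT : IsCompactOperator T) :
    T ∈ (Submodule.span ℂ {X | ∃ (v : L) (w : K), X = rankOne ℂ v w}).topologicalClosure := by
  refine Metric.mem_closure_iff.2 fun ε hε => ?_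
  have hc : TotallyBounded (T '' Metric.closedBall 0 1) :=
    ((hT.isCompact_closure_image_closedBall 1).totallyBounded).subset subset_closure
  obtain ⟨t, ht, hcov⟩ := Metric.totallyBounded_iff.1 hc (ε / 2) (half_pos hε)
  let U : Submodule ℂ L := Submodule.span ℂ t
  have : FiniteDimensional ℂ U := FiniteDimensional.span_of_finite ℂ ht
  refine ⟨U.starProjection ∘L T, ?_, ?_⟩
  · have e : U.starProjection ∘L T = ∑ i, rankOne ℂ ((stdOrthonormalBasis ℂ U i : U) : L)
        (adjoint T (stdOrthonormalBasis ℂ U i : U)) := by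
      rw [(stdOrthonormalBasis ℂ U).starProjection_eq_sum_rankOne]
      ext x
      simp [ContinuousLinearMap.adjoint_inner_left]
    rw [e]
    exact Submodule.sum_mem _ fun i _ => Submodule.subset_span ⟨_, _, rfl⟩
  · rw [dist_eq_norm]
    refine lt_of_le_of_lt (ContinuousLinearMap.opNorm_le_of_unit_norm (by positivity)
      fun x hx => ?_) (half_lt_self hε)
    have hx' : T x ∈ T '' Metric.closedBall 0 1 := ⟨x, by simp [hx], rfl⟩
    obtain ⟨y, hy, hxy⟩ := Set.mem_iUnion₂.1 (hcov hx')
    have h1 : ‖T x - U.starProjection (T x)‖ ≤ ‖T x - y‖ := by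
      rw [Submodule.starProjection_minimal]
      exact ciInf_le ⟨0, by rintro _ ⟨z, rfl⟩; positivity⟩ (⟨y, Submodule.subset_span hy⟩ : U)
    rw [Metric.mem_ball, dist_eq_norm] at hxy
    simpa using h1.trans hxy.le

end Compact

/-! ### The spaces `A ⊗ 𝒦(K, L)` -/

section CompactTensor

variable {A : Type*} [CStarAlgebra A]
variable {HA : Type*} [NormedAddCommGroup HA] [InnerProductSpace ℂ HA] [CompleteSpace HA]
variable (π : A →⋆ₐ[ℂ] (HA →L[ℂ] HA))
variable {K L M : Type*} [NormedAddCommGroup K] [InnerProductSpace ℂ K]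
  [NormedAddCommGroup L] [InnerProductSpace ℂ L] [NormedAddCommGroup M] [InnerProductSpace ℂ M]

variable (K L) in
/-- The space `tensorCompact π K L`, for the type synonyms of the tensor products. -/
def compactTensor : Submodule ℂ (HilbertTensor HA K →L[ℂ] HilbertTensor HA L) :=
  (Submodule.span ℂ {X | ∃ (a : A) (T : K →L[ℂ] L), IsCompactOperator T ∧
    X = opTensor (π a) T}).topologicalClosure

theorem isClosed_compactTensor :
    IsClosed (compactTensor π K L : Set (HilbertTensor HA K →L[ℂ] HilbertTensor HA L)) :=
  Submodule.isClosed_topologicalClosure _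

variable {π} in
theorem opTensor_mem_compactTensor {T : K →L[ℂ] L} (hT : IsCompactOperator T) (a : A) :
    opTensor (π a) T ∈ compactTensor π K L :=
  Submodule.le_topologicalClosure _ (Submodule.subset_span ⟨a, T, hT, rfl⟩)

/-- `A ⊗ 𝒦(K, L)` is generated by the operators `π(a) ⊗ T` with `T` of rank one. -/
theorem compactTensor_le [CompleteSpace K] [CompleteSpace L]
    {S : Submodule ℂ (HilbertTensor HA K →L[ℂ] HilbertTensor HA L)}
    (hS : IsClosed (S : Set (HilbertTensor HA K →L[ℂ] HilbertTensor HA L)))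
    (h : ∀ (a : A) (v : L) (w : K), opTensor (π a) (rankOne ℂ v w) ∈ S) :
    compactTensor π K L ≤ S := by
  refine Submodule.topologicalClosure_minimal _ (Submodule.span_le.2 ?_) hS
  rintro _ ⟨a, T, hT, rfl⟩
  have hle : (Submodule.span ℂ {X | ∃ (v : L) (w : K), X = rankOne ℂ v w}).topologicalClosure ≤
      S.comap (opTensorL HA HA K L (π a)).toLinearMap := by
    refine Submodule.topologicalClosure_minimal _ (Submodule.span_le.2 ?_)
      (hS.preimage (opTensorL HA HA K L (π a)).continuous)
    rintro _ ⟨v, w, rfl⟩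
    exact h a v w
  exact hle (IsCompactOperator.mem_closure_span_rankOne hT)

variable {π}

theorem adjoint_mem_compactTensor [CompleteSpace K] [CompleteSpace L]
    {X : HilbertTensor HA K →L[ℂ] HilbertTensor HA L} (hX : X ∈ compactTensor π K L) :
    adjoint X ∈ compactTensor π L K := by
  let S : Submodule ℂ (HilbertTensor HA K →L[ℂ] HilbertTensor HA L) :=
    { carrier := {X | adjoint X ∈ compactTensor π L K}
      add_mem' := fun {X Y} hX hY => by
        simp only [Set.mem_ofPred_eq, map_add]; exact add_mem hX hY
      zero_mem' := by simp
      smul_mem' := fun c X hX => by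
        simp only [Set.mem_ofPred_eq, map_smulₛₗ]; exact Submodule.smul_mem _ _ hX }
  have hS : IsClosed (S : Set (HilbertTensor HA K →L[ℂ] HilbertTensor HA L)) :=
    (isClosed_compactTensor π).preimage (adjoint (𝕜 := ℂ) (E := HilbertTensor HA K)
      (F := HilbertTensor HA L)).continuous
  refine compactTensor_le π hS (fun a v w => ?_) hX
  change adjoint (opTensor (π a) (rankOne ℂ v w)) ∈ compactTensor π L K
  rw [adjoint_opTensor, adjoint_rankOne, ← ContinuousLinearMap.star_eq_adjoint, ← map_star]
  exact opTensor_mem_compactTensor (isCompactOperator_rankOne w v) _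

theorem comp_mem_compactTensor {X : HilbertTensor HA L →L[ℂ] HilbertTensor HA M}
    {Y : HilbertTensor HA K →L[ℂ] HilbertTensor HA L} (hX : X ∈ compactTensor π L M)
    (hY : Y ∈ compactTensor π K L) : X ∘L Y ∈ compactTensor π K M := by
  have key (b : A) (T' : K →L[ℂ] L) (hT' : IsCompactOperator T') :
      compactTensor π L M ≤ (compactTensor π K M).comap
        ((ContinuousLinearMap.compL ℂ _ _ _).flip (opTensor (π b) T')).toLinearMap := by
    refine Submodule.topologicalClosure_minimal _ (Submodule.span_le.2 ?_)
      ((isClosed_compactTensor π).preimage (ContinuousLinearMap.continuous _))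
    rintro _ ⟨a, T, hT, rfl⟩
    change opTensor (π a) T ∘L opTensor (π b) T' ∈ compactTensor π K M
    rw [opTensor_comp, ← ContinuousLinearMap.mul_def, ← map_mul]
    exact opTensor_mem_compactTensor (hT.comp_clm T') _
  have key2 : compactTensor π K L ≤ (compactTensor π K M).comap
        (ContinuousLinearMap.compL ℂ _ _ _ X).toLinearMap := by
    refine Submodule.topologicalClosure_minimal _ (Submodule.span_le.2 ?_)
      ((isClosed_compactTensor π).preimage (ContinuousLinearMap.continuous _))
    rintro _ ⟨b, T', hT', rfl⟩
    exact key b T' hT' hX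
  exact key2 hY

end CompactTensor

/-! ### Unitary representations and convolution operators -/

namespace UnitaryRep

section Continuity

variable {H : Type*} [NormedAddCommGroup H] [InnerProductSpace ℂ H]

/-- Strong continuity of a uniformly bounded family of operators only has to be checked on vectors
whose closed linear span is the whole space. -/
theorem continuous_of_total {X : Type*} [TopologicalSpace X] {T : X → H →L[ℂ] H}
    (hT : ∀ g, ‖T g‖ ≤ 1) {s : Set H} (hs : (Submodule.span ℂ s).topologicalClosure = ⊤)
    (h : ∀ x ∈ s, Continuous fun g => T g x) (x : H) : Continuous fun g => T g x := by
  let S : Submodule ℂ H :=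
    { carrier := {x | Continuous fun g => T g x}
      add_mem' := fun {x y} hx hy => by
        simp only [Set.mem_ofPred_eq, map_add]
        exact Continuous.add hx hy
      zero_mem' := by simpa using continuous_const
      smul_mem' := fun c x hx => by
        simp only [Set.mem_ofPred_eq, map_smul]
        exact Continuous.const_smul hx c }
  have hS : IsClosed (S : Set H) := by
    refine isClosed_of_closure_subset fun x hx => ?_
    refine continuous_of_uniform_approx_of_continuous fun U hU => ?_
    obtain ⟨ε, hε, hεU⟩ := Metric.mem_uniformity_dist.1 hU
    obtain ⟨y, hy, hxy⟩ := Metric.mem_closure_iff.1 hx ε hε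
    refine ⟨fun g => T g y, hy, fun g => hεU ?_⟩
    rw [dist_eq_norm, ← map_sub]
    rw [dist_eq_norm] at hxy
    exact ((T g).le_of_opNorm_le (hT g) _).trans_lt (by rwa [one_mul])
  have : S = ⊤ := top_le_iff.1
    (hs ▸ Submodule.topologicalClosure_minimal _ (Submodule.span_le.2 h) hS)
  exact (this ▸ Submodule.mem_top : x ∈ S)

end Continuity

section Basic

variable {G : Type*} [Group G] [TopologicalSpace G]
variable {H : Type*} [NormedAddCommGroup H] [InnerProductSpace ℂ H] [CompleteSpace H]

theorem op_mul_apply (u : UnitaryRep G H) (g k : G) (x : H) :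
    u.op (g * k) x = u.op g (u.op k x) := by
  simp [op]

@[simp]
theorem op_one_apply (u : UnitaryRep G H) (x : H) : u.op 1 x = x := by
  simp [op]

@[simp]
theorem op_inv_op (u : UnitaryRep G H) (g : G) (x : H) : u.op g⁻¹ (u.op g x) = x := by
  rw [← op_mul_apply, inv_mul_cancel, op_one_apply]

@[simp]
theorem op_op_inv (u : UnitaryRep G H) (g : G) (x : H) : u.op g (u.op g⁻¹ x) = x := by
  rw [← op_mul_apply, mul_inv_cancel, op_one_apply]

theorem inner_op_op (u : UnitaryRep G H) (g : G) (x y : H) :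
    inner ℂ (u.op g x) (u.op g y) = inner ℂ x y := by
  have h : star (u.op g) * u.op g = 1 := Unitary.coe_star_mul_self (u.toHom g)
  rw [← ContinuousLinearMap.adjoint_inner_right, ← ContinuousLinearMap.star_eq_adjoint,
    ← mul_apply_eq_comp, h, one_apply_eq_self]

@[simp]
theorem norm_op_apply (u : UnitaryRep G H) (g : G) (x : H) : ‖u.op g x‖ = ‖x‖ := by
  rw [@norm_eq_sqrt_re_inner ℂ, inner_op_op, ← @norm_eq_sqrt_re_inner ℂ]

theorem inner_op_left (u : UnitaryRep G H) (g : G) (x y : H) :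
    inner ℂ (u.op g x) y = inner ℂ x (u.op g⁻¹ y) := by
  rw [← u.inner_op_op g x, op_op_inv]

theorem adjoint_op (u : UnitaryRep G H) (g : G) : adjoint (u.op g) = u.op g⁻¹ := by
  ext x
  refine ext_inner_left ℂ fun y => ?_
  rw [ContinuousLinearMap.adjoint_inner_right, inner_op_left]

theorem norm_op_le (u : UnitaryRep G H) (g : G) : ‖u.op g‖ ≤ 1 :=
  ContinuousLinearMap.opNorm_le_bound _ zero_le_one fun x => by simp

/-- A unitary representation from a multiplicative, isometric and strongly continuous family of
operators. -/
def ofIsometric (T : G → H →L[ℂ] H) (h1 : T 1 = 1) (hmul : ∀ g k, T (g * k) = T g * T k)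
    (hnorm : ∀ g x, ‖T g x‖ = ‖x‖) (hcont : ∀ x, Continuous fun g => T g x) :
    UnitaryRep G H where
  toHom :=
    { toFun := fun g => ⟨T g, by
        have h2 : star (T g) * T g = 1 :=
          (ContinuousLinearMap.norm_map_iff_adjoint_comp_self (T g)).1 (hnorm g)
        have h3 : T g * T g⁻¹ = 1 := by rw [← hmul, mul_inv_cancel, h1]
        have h4 : star (T g) = T g⁻¹ := by
          rw [← mul_one (star (T g)), ← h3, ← mul_assoc, h2, one_mul]
        exact Unitary.mem_iff.2 ⟨h2, by rw [h4, h3]⟩⟩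
      map_one' := Subtype.ext h1
      map_mul' := fun g k => Subtype.ext (hmul g k) }
  continuous_apply := hcont

/-- The restriction of a unitary representation to a closed invariant subspace. -/
def restrict (u : UnitaryRep G H) (W : Submodule ℂ H) [CompleteSpace W]
    (hW : ∀ g, ∀ x ∈ W, u.op g x ∈ W) : UnitaryRep G W :=
  ofIsometric (fun g => (u.op g ∘L W.subtypeL).codRestrict W fun x : W => by
      exact hW g x x.2)
    (ContinuousLinearMap.ext fun x => Subtype.ext (u.op_one_apply x))
    (fun g k => ContinuousLinearMap.ext fun x => Subtype.ext (u.op_mul_apply g k x))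
    (fun g x => u.norm_op_apply g x)
    (fun x => (u.continuous_apply x).subtype_mk _)

end Basic

section DirectSum

variable {G : Type*} [Group G] [TopologicalSpace G] {ι : Type*} {E : ι → Type*}
  [∀ i, NormedAddCommGroup (E i)] [∀ i, InnerProductSpace ℂ (E i)]

theorem span_single_eq_top [DecidableEq ι] :
    (Submodule.span ℂ {x : lp E 2 | ∃ i a, x = lp.single 2 i a}).topologicalClosure = ⊤ := by
  refine Submodule.eq_top_iff'.2 fun x => ?_
  refine mem_closure_of_tendsto (lp.hasSum_single (by simp) x) (.of_forall fun s => ?_)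
  exact Submodule.sum_mem _ fun i _ => Submodule.subset_span ⟨i, _, rfl⟩

variable [∀ i, CompleteSpace (E i)]

/-- The Hilbert space direct sum of unitary representations. -/
def directSum (u : ∀ i, UnitaryRep G (E i)) : UnitaryRep G (lp E 2) := by
  classical
  exact ofIsometric
    (fun g => lp.mapCLM 2 (fun i => (u i).op g) zero_le_one fun i => (u i).norm_op_le g)
    (by ext x i; simp) (fun g k => by ext x i; simp [op_mul_apply])
    (fun g x => by
      rw [← sq_eq_sq₀ (norm_nonneg _) (norm_nonneg _)]
      have h (y : lp E 2) : ‖y‖ ^ 2 = ∑' i, ‖y i‖ ^ 2 := by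
        simpa using lp.norm_rpow_eq_tsum (p := 2) (by simp) y
      simp [h])
    (continuous_of_total (fun g => lp.norm_mapCLM_le _ _ _ _) span_single_eq_top (by
      rintro _ ⟨i, a, rfl⟩
      have h : (fun g => lp.mapCLM 2 (fun i => (u i).op g) zero_le_one
          (fun i => (u i).norm_op_le g) (lp.single 2 i a)) =
          fun g => lp.single 2 i ((u i).op g a) := by
        funext g
        ext j
        by_cases hj : j = i
        · subst hj; simp
        · simp [hj]
      rw [h]
      exact (lp.isometry_single i).continuous.comp ((u i).continuous_apply a)))

@[simp]
theorem directSum_op_apply (u : ∀ i, UnitaryRep G (E i)) (g : G) (x : lp E 2) (i : ι) :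
    (directSum u).op g x i = (u i).op g (x i) := rfl

end DirectSum

section Convolution

variable {G : Type*} [Group G] [TopologicalSpace G] [IsTopologicalGroup G] [CompactSpace G]
  [MeasurableSpace G] [BorelSpace G]
variable {H : Type*} [NormedAddCommGroup H] [InnerProductSpace ℂ H] [CompleteSpace H]
variable {K : Type*} [NormedAddCommGroup K] [InnerProductSpace ℂ K] [CompleteSpace K]

theorem integrable_mollifier_smul (u : UnitaryRep G H) (h : Mollifier G) (x : H) :
    Integrable (fun g => h g • u.op g x) (haarProb G) :=
  integrable_haarProb (h.continuous_smul (u.continuous_apply x))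

/-- The operator `∫ h(g) u_g dg`. -/
def conv (u : UnitaryRep G H) (h : Mollifier G) : H →L[ℂ] H :=
  LinearMap.mkContinuous
    { toFun := fun x => ∫ g, h g • u.op g x ∂haarProb G
      map_add' := fun x y => by
        simp only [map_add, smul_add]
        exact integral_add (u.integrable_mollifier_smul h x) (u.integrable_mollifier_smul h y)
      map_smul' := fun c x => by
        simp only [map_smul, smul_comm _ c, RingHom.id_apply]
        exact integral_smul c _ }
    1 fun x => by
      rw [one_mul]
      exact h.norm_integral_smul_le fun g => (u.norm_op_apply g x).le

theorem conv_apply (u : UnitaryRep G H) (h : Mollifier G) (x : H) :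
    u.conv h x = ∫ g, h g • u.op g x ∂haarProb G := rfl

/-- Intertwiners carry convolution operators to convolution operators. -/
theorem conv_intertwine (u : UnitaryRep G H) (u' : UnitaryRep G K) (h : Mollifier G)
    {T : H →L[ℂ] K} (hT : ∀ g x, T (u.op g x) = u'.op g (T x)) (x : H) :
    T (u.conv h x) = u'.conv h (T x) := by
  rw [conv_apply, conv_apply, ← T.integral_comp_comm (u.integrable_mollifier_smul h x)]
  simp only [ContinuousLinearMap.map_smul_of_tower, hT]

/-- Convolution operators commute with the representation, since mollifiers are invariant under
conjugation. -/
theorem conv_op (u : UnitaryRep G H) (h : Mollifier G) (k : G) (x : H) :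
    u.conv h (u.op k x) = u.op k (u.conv h x) := by
  rw [conv_apply, conv_apply, ← (u.op k).integral_comp_comm (u.integrable_mollifier_smul h x),
    ← integral_mul_right_eq_self _ k⁻¹,
    ← integral_mul_left_eq_self (fun g => h (g * k⁻¹) • u.op (g * k⁻¹) (u.op k x)) k]
  simp only [ContinuousLinearMap.map_smul_of_tower, ← op_mul_apply, h.conj_eq,
    inv_mul_cancel_right]

/-- Convolution operators are self-adjoint, since mollifiers are real and invariant under
inversion. -/
theorem isSymmetric_conv (u : UnitaryRep G H) (h : Mollifier G) : (u.conv h).IsSymmetric := by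
  intro x y
  have h1 : inner ℂ x (u.conv h y) = ∫ g, h g • inner ℂ x (u.op g y) ∂haarProb G := by
    rw [conv_apply, ← innerSL_apply_apply ℂ,
      ← (innerSL ℂ x).integral_comp_comm (u.integrable_mollifier_smul h y)]
    simp only [ContinuousLinearMap.map_smul_of_tower, innerSL_apply_apply]
  have h2 : inner ℂ y (u.conv h x) = ∫ g, h g • inner ℂ y (u.op g x) ∂haarProb G := by
    rw [conv_apply, ← innerSL_apply_apply ℂ,
      ← (innerSL ℂ y).integral_comp_comm (u.integrable_mollifier_smul h x)]
    simp only [ContinuousLinearMap.map_smul_of_tower, innerSL_apply_apply]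
  change inner ℂ (u.conv h x) y = inner ℂ x (u.conv h y)
  rw [← inner_conj_symm, h1, h2, ← integral_conj, ← integral_inv_eq_self _ (haarProb G)]
  congr 1
  funext g
  rw [h.inv_eq, Complex.real_smul, Complex.real_smul, map_mul, Complex.conj_ofReal,
    inner_conj_symm, inner_op_left, inv_inv]

theorem exists_norm_conv_sub_le (u : UnitaryRep G H) (x : H) {ε : ℝ} (hε : 0 < ε) :
    ∃ h : Mollifier G, ‖u.conv h x - x‖ ≤ ε := by
  obtain ⟨h, hh⟩ := exists_mollifier (u.continuous_apply x) hε
  exact ⟨h, by simpa [conv_apply, op] using hh⟩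

end Convolution

end UnitaryRep

/-! ### Regular representations and compactness of convolution operators -/

section Regular

variable {G : Type*} [Group G] [TopologicalSpace G] [IsTopologicalGroup G] [CompactSpace G]
  [MeasurableSpace G] [BorelSpace G]

variable (G) in
/-- The map from continuous functions to `L²(G)`. -/
def toL2 : C(G, ℂ) →L[ℂ] L2 G := ContinuousMap.toLp 2 (haarProb G) ℂ

theorem inner_toL2 (a b : C(G, ℂ)) :
    inner ℂ (toL2 G a) (toL2 G b) = ∫ x, b x * starRingEnd ℂ (a x) ∂haarProb G :=
  ContinuousMap.inner_toLp (haarProb G) a b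

theorem leftReg_toL2 (g : G) (φ : C(G, ℂ)) :
    leftReg g (toL2 G φ) = toL2 G (φ.comp ⟨(g⁻¹ * ·), by fun_prop⟩) := by
  have hm := measurePreserving_mul_left (haarProb G) g⁻¹
  refine Lp.ext ?_
  refine (Lp.coeFn_compMeasurePreserving (toL2 G φ) hm).trans ?_
  refine (hm.quasiMeasurePreserving.ae_eq_comp (ContinuousMap.coeFn_toLp (haarProb G) φ)).trans ?_
  exact (ContinuousMap.coeFn_toLp (𝕜 := ℂ) (p := 2) (haarProb G) (φ.comp ⟨(g⁻¹ * ·), _⟩)).symm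

theorem rightReg_toL2 (g : G) (φ : C(G, ℂ)) :
    rightReg g (toL2 G φ) = toL2 G (φ.comp ⟨(· * g), by fun_prop⟩) := by
  have hm := measurePreserving_mul_right (haarProb G) g
  refine Lp.ext ?_
  refine (Lp.coeFn_compMeasurePreserving (toL2 G φ) hm).trans ?_
  refine (hm.quasiMeasurePreserving.ae_eq_comp (ContinuousMap.coeFn_toLp (haarProb G) φ)).trans ?_
  exact (ContinuousMap.coeFn_toLp (𝕜 := ℂ) (p := 2) (haarProb G) (φ.comp ⟨(· * g), _⟩)).symm

/-- The kernel `(x, y) ↦ h(x⁻¹ y)`. -/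
def convKernel (h : Mollifier G) : C(G, L2 G →L[ℂ] ℂ) :=
  let T : C(G, C(G, ℂ)) := ContinuousMap.curry
    ⟨fun p : G × G => (h (p.1⁻¹ * p.2) : ℂ), by have := h.continuous; fun_prop⟩
  ⟨fun x => innerSL ℂ (toL2 G (T x)), by fun_prop⟩

theorem convKernel_toL2 (h : Mollifier G) (x : G) (φ : C(G, ℂ)) :
    convKernel h x (toL2 G φ) = ∫ y, h (x⁻¹ * y) • φ y ∂haarProb G := by
  change inner ℂ (toL2 G _) (toL2 G φ) = _
  rw [inner_toL2]
  congr 1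
  funext y
  simp [mul_comm]

variable (G) in
/-- The operator on `L²(G)` with kernel `c`, that is `f ↦ (x ↦ c(x) f)`, where `c` is a continuous
function with values in the dual of `L²(G)`. -/
def kernelOp : C(G, L2 G →L[ℂ] ℂ) →L[ℂ] L2 G →L[ℂ] L2 G :=
  LinearMap.mkContinuous₂
    (LinearMap.mk₂ ℂ (fun (c : C(G, L2 G →L[ℂ] ℂ)) (f : L2 G) => toL2 G ⟨fun x => c x f, by fun_prop⟩)
      (fun c c' f => by rw [← map_add]; rfl)
      (fun a c f => by rw [← map_smul]; rfl)
      (fun c f f' => by rw [← map_add]; congr 1; ext x; simp)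
      (fun a c f => by rw [← map_smul]; congr 1; ext x; simp))
    ‖toL2 G‖ fun c f => by
      rw [mul_assoc]
      refine (toL2 G).le_opNorm_of_le ((ContinuousMap.norm_le _ (by positivity)).2 fun x => ?_)
      exact (c x).le_of_opNorm_le (c.norm_coe_le_norm x) f

theorem kernelOp_apply (c : C(G, L2 G →L[ℂ] ℂ)) (f : L2 G) :
    kernelOp G c f = toL2 G ⟨fun x => c x f, by fun_prop⟩ := rfl

/-- Operators with continuous kernels are compact, since the kernel is a uniform limit of kernels
of finite rank. -/
theorem isCompactOperator_kernelOp (c : C(G, L2 G →L[ℂ] ℂ)) :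
    IsCompactOperator (kernelOp G c) := by
  let S : Submodule ℂ C(G, L2 G →L[ℂ] ℂ) :=
    (compactOperator (RingHom.id ℂ) (L2 G) (L2 G)).comap (kernelOp G).toLinearMap
  have hS : IsClosed (S : Set C(G, L2 G →L[ℂ] ℂ)) :=
    isClosed_setOfPred_isCompactOperator.preimage (kernelOp G).continuous
  have htop : S = ⊤ := by
    refine eq_top_of_mollifier_smul_mem hS fun m y v f hf => ?_
    change IsCompactOperator (kernelOp G f)
    let ψ : C(G, ℂ) := ⟨fun x => (m (x⁻¹ * y) : ℂ), by have := m.continuous; fun_prop⟩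
    have : kernelOp G f = ContinuousLinearMap.toSpanSingleton ℂ (toL2 G ψ) ∘L v := by
      ext1 z
      rw [kernelOp_apply, ContinuousLinearMap.comp_apply,
        ContinuousLinearMap.toSpanSingleton_apply, ← map_smul]
      congr 1
      ext x
      simp [hf, ψ, mul_comm]
    rw [this]
    exact isCompactOperator_of_factor _ _
  exact (htop ▸ Submodule.mem_top : c ∈ S)

variable [T2Space G]

theorem denseRange_toL2 : DenseRange (toL2 G) :=
  ContinuousMap.toLp_denseRange ℂ (haarProb G) ℂ (by simp)

theorem clm_ext_toL2 {X : Type*} [NormedAddCommGroup X] [NormedSpace ℂ X] {S T : L2 G →L[ℂ] X}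
    (h : ∀ φ, S (toL2 G φ) = T (toL2 G φ)) : S = T :=
  ContinuousLinearMap.ext <| congrFun <|
    denseRange_toL2.equalizer S.continuous T.continuous (funext h)

variable (G) in
/-- The left regular representation. -/
def leftRep : UnitaryRep G (L2 G) :=
  UnitaryRep.ofIsometric leftReg
    (clm_ext_toL2 fun φ => by
      rw [leftReg_toL2, one_apply_eq_self]; congr 1; ext x; simp)
    (fun g k => clm_ext_toL2 fun φ => by
      rw [mul_apply_eq_comp, leftReg_toL2, leftReg_toL2, leftReg_toL2]
      congr 1; ext x; simp [mul_assoc])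
    (fun g x => LinearIsometry.norm_map _ x)
    (fun x => by
      let T : C(G, C(G, G)) := ContinuousMap.curry ⟨fun p : G × G => p.1⁻¹ * p.2, by fun_prop⟩
      exact (continuous_const (y := x)).compMeasurePreservingLp T.continuous
        (fun g => measurePreserving_mul_left (haarProb G) g⁻¹) (by simp))

variable (G) in
/-- The right regular representation. -/
def rightRep : UnitaryRep G (L2 G) :=
  UnitaryRep.ofIsometric rightReg
    (clm_ext_toL2 fun φ => by
      rw [rightReg_toL2, one_apply_eq_self]; congr 1; ext x; simp)
    (fun g k => clm_ext_toL2 fun φ => by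
      rw [mul_apply_eq_comp, rightReg_toL2, rightReg_toL2, rightReg_toL2]
      congr 1; ext x; simp [mul_assoc])
    (fun g x => LinearIsometry.norm_map _ x)
    (fun x => by
      let T : C(G, C(G, G)) := ContinuousMap.curry ⟨fun p : G × G => p.2 * p.1, by fun_prop⟩
      exact (continuous_const (y := x)).compMeasurePreservingLp T.continuous
        (fun g => measurePreserving_mul_right (haarProb G) g) (by simp))

@[simp]
theorem leftRep_op (g : G) : (leftRep G).op g = leftReg g := rfl

@[simp]
theorem rightRep_op (g : G) : (rightRep G).op g = rightReg g := rfl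

theorem leftReg_rightReg (g k : G) (f : L2 G) :
    leftReg g (rightReg k f) = rightReg k (leftReg g f) := by
  have : leftReg g ∘L rightReg k = rightReg k ∘L leftReg g := clm_ext_toL2 fun φ => by
    simp only [ContinuousLinearMap.comp_apply, leftReg_toL2, rightReg_toL2]
    congr 1; ext x; simp [mul_assoc]
  exact congr($this f)

theorem conv_rightRep_eq_kernelOp (h : Mollifier G) :
    (rightRep G).conv h = kernelOp G (convKernel h) := by
  refine clm_ext_toL2 fun φ => ?_
  let T : C(G, C(G, ℂ)) := ContinuousMap.curry ⟨fun p : G × G => φ (p.2 * p.1), by fun_prop⟩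
  have hT (g : G) : rightReg g (toL2 G φ) = toL2 G (T g) := rightReg_toL2 g φ
  have hi := integrable_haarProb (h.continuous_smul T.continuous)
  have e : (rightRep G).conv h (toL2 G φ) = toL2 G (∫ g, h g • T g ∂haarProb G) := by
    rw [← (toL2 G).integral_comp_comm hi]
    simp only [UnitaryRep.conv_apply, rightRep_op, hT, ContinuousLinearMap.map_smul_of_tower]
    rfl
  rw [e, kernelOp_apply]
  congr 1
  ext x
  refine (ContinuousMap.integral_apply hi x).trans (.trans ?_ (convKernel_toL2 h x φ).symm)
  rw [← integral_mul_left_eq_self (fun y => h (x⁻¹ * y) • φ y) x]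
  simp [T]

theorem conv_leftRep_eq_kernelOp (h : Mollifier G) :
    (leftRep G).conv h = kernelOp G (convKernel h) := by
  refine clm_ext_toL2 fun φ => ?_
  let T : C(G, C(G, ℂ)) := ContinuousMap.curry ⟨fun p : G × G => φ (p.1⁻¹ * p.2), by fun_prop⟩
  have hT (g : G) : leftReg g (toL2 G φ) = toL2 G (T g) := leftReg_toL2 g φ
  have hi := integrable_haarProb (h.continuous_smul T.continuous)
  have e : (leftRep G).conv h (toL2 G φ) = toL2 G (∫ g, h g • T g ∂haarProb G) := by
    rw [← (toL2 G).integral_comp_comm hi]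
    simp only [UnitaryRep.conv_apply, leftRep_op, hT, ContinuousLinearMap.map_smul_of_tower]
    rfl
  rw [e, kernelOp_apply]
  congr 1
  ext x
  refine (ContinuousMap.integral_apply hi x).trans (.trans ?_ (convKernel_toL2 h x φ).symm)
  rw [← integral_inv_eq_self (fun y => (h y • T y) x),
    ← integral_mul_right_eq_self (fun y => (h y⁻¹ • T y⁻¹) x) x⁻¹]
  congr 1
  funext y
  simp only [ContinuousMap.smul_apply, h.inv_eq, h.mul_comm_eq y x⁻¹]
  simp [T]

/-- The convolution operator by a conjugation invariant function is the same for the two regular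
representations. -/
theorem conv_leftRep (h : Mollifier G) : (leftRep G).conv h = (rightRep G).conv h := by
  rw [conv_leftRep_eq_kernelOp, conv_rightRep_eq_kernelOp]

theorem isCompactOperator_conv (h : Mollifier G) : IsCompactOperator ((leftRep G).conv h) := by
  rw [conv_leftRep_eq_kernelOp]
  exact isCompactOperator_kernelOp _

end Regular

/-! ### The decomposition of `L²(G)` into finite-dimensional bi-invariant subspaces -/

theorem UnitaryRep.starProjection_op {G : Type*} [Group G] [TopologicalSpace G]
    {H : Type*} [NormedAddCommGroup H] [InnerProductSpace ℂ H] [CompleteSpace H]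
    (u : UnitaryRep G H) (W : Submodule ℂ H) [W.HasOrthogonalProjection]
    (hW : ∀ g, ∀ x ∈ W, u.op g x ∈ W) (g : G) (x : H) :
    W.starProjection (u.op g x) = u.op g (W.starProjection x) := by
  refine (Submodule.eq_starProjection_of_mem_of_inner_eq_zero
    (hW g _ (W.starProjection_apply_mem x)) fun w hw => ?_)
  rw [← map_sub, u.inner_op_left]
  exact W.starProjection_inner_eq_zero x _ (hW g⁻¹ w hw)

section Blocks

variable {G : Type*} [Group G] [TopologicalSpace G] [IsTopologicalGroup G] [CompactSpace G]
  [MeasurableSpace G] [BorelSpace G]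

variable (G) in
/-- A finite-dimensional subspace of `L²(G)` invariant under left and right translations. -/
@[ext]
structure Block where
  /-- the underlying subspace -/
  toSubmodule : Submodule ℂ (L2 G)
  finiteDimensional : FiniteDimensional ℂ toSubmodule
  leftReg_mem : ∀ g, ∀ f ∈ toSubmodule, leftReg g f ∈ toSubmodule
  rightReg_mem : ∀ g, ∀ f ∈ toSubmodule, rightReg g f ∈ toSubmodule

instance (B : Block G) : FiniteDimensional ℂ B.toSubmodule := B.finiteDimensional

/-- On an irreducible representation on `ℂⁿ` some convolution operator is a nonzero scalar. -/
theorem exists_conv_eq_smul {V : Type*} [NormedAddCommGroup V] [InnerProductSpace ℂ V]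
    [FiniteDimensional ℂ V] [CompleteSpace V] {σ : UnitaryRep G V} (hσ : σ.IsIrreducible) :
    ∃ (h : Mollifier G) (c : ℂ), c ≠ 0 ∧ ∀ x, σ.conv h x = c • x := by
  have := hσ.1
  obtain ⟨v, hv⟩ := exists_ne (0 : V)
  obtain ⟨h, hh⟩ := σ.exists_norm_conv_sub_le v (half_pos (norm_pos_iff.2 hv))
  have h0 : σ.conv h ≠ 0 := by
    intro h0
    rw [h0, zero_apply, zero_sub, norm_neg] at hh
    have := norm_pos_iff.2 hv
    linarith
  have hc : IsCompactOperator (σ.conv h) :=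
    isCompactOperator_of_factor (σ.conv h) (ContinuousLinearMap.id ℂ V)
  obtain ⟨c, hc, hc0⟩ : ∃ c, Module.End.HasEigenvalue (σ.conv h : Module.End ℂ V) c ∧ c ≠ 0 := by
    by_contra! hcon
    exact h0 ((ContinuousLinearMap.eq_zero_of_forall_hasEigenvalue_eq_zero hc
      (σ.isSymmetric_conv h)).1 hcon)
  refine ⟨h, c, hc0, fun x => ?_⟩
  have htop := (hσ.2 (Module.End.eigenspace (σ.conv h : Module.End ℂ V) c)
    (Submodule.closed_of_finiteDimensional _) fun g x hx => by
      rw [Module.End.mem_eigenspace_iff] at hx ⊢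
      exact (σ.conv_op h g x).trans (by rw [← map_smul]; exact congrArg _ hx)).resolve_left hc
  exact Module.End.mem_eigenspace_iff.1 (htop ▸ Submodule.mem_top : x ∈ _)

variable [T2Space G]

/-- A closed bi-invariant subspace of `L²(G)` that is not zero contains a nonzero block, namely an
eigenspace of the compression of a convolution operator. -/
theorem exists_block_le {M : Submodule ℂ (L2 G)} [M.HasOrthogonalProjection] (hM : M ≠ ⊥)
    (hl : ∀ g, ∀ f ∈ M, leftReg g f ∈ M) (hr : ∀ g, ∀ f ∈ M, rightReg g f ∈ M) :
    ∃ B : Block G, B.toSubmodule ≤ M ∧ B.toSubmodule ≠ ⊥ := by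
  obtain ⟨f, hfM, hf0⟩ := (Submodule.ne_bot_iff M).1 hM
  have hfpos : 0 < ‖f‖ := norm_pos_iff.2 hf0
  obtain ⟨h, hh⟩ := (rightRep G).exists_norm_conv_sub_le f (half_pos hfpos)
  set P := M.starProjection
  let T : L2 G →L[ℂ] L2 G := P ∘L (rightRep G).conv h ∘L P
  have hPl (g : G) (x : L2 G) : P (leftReg g x) = leftReg g (P x) :=
    (leftRep G).starProjection_op M hl g x
  have hPr (g : G) (x : L2 G) : P (rightReg g x) = rightReg g (P x) :=
    (rightRep G).starProjection_op M hr g x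
  have hcl (g : G) (x : L2 G) : (rightRep G).conv h (leftReg g x) =
      leftReg g ((rightRep G).conv h x) := by
    rw [← conv_leftRep]; exact (leftRep G).conv_op h g x
  have hcr (g : G) (x : L2 G) : (rightRep G).conv h (rightReg g x) =
      rightReg g ((rightRep G).conv h x) := (rightRep G).conv_op h g x
  have hTl (g : G) (x : L2 G) : T (leftReg g x) = leftReg g (T x) := by
    simp only [T, ContinuousLinearMap.comp_apply, hPl, hcl]
  have hTr (g : G) (x : L2 G) : T (rightReg g x) = rightReg g (T x) := by
    simp only [T, ContinuousLinearMap.comp_apply, hPr, hcr]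
  have hTc : IsCompactOperator T := by
    have := isCompactOperator_conv h
    rw [conv_leftRep] at this
    exact (this.comp_clm P).clm_comp P
  have hPs : ∀ x y, inner ℂ (P x) y = inner ℂ x (P y) := fun x y =>
    M.inner_starProjection_left_eq_right x y
  have hTs : T.IsSymmetric := fun x y => by
    change inner ℂ (P ((rightRep G).conv h (P x))) y = inner ℂ x (P ((rightRep G).conv h (P y)))
    rw [hPs, ← hPs x]
    exact (rightRep G).isSymmetric_conv h _ _
  have hPf : P f = f := M.starProjection_eq_self_iff.2 hfM
  have hT0 : T ≠ 0 := by
    intro h0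
    have h1 : inner ℂ f ((rightRep G).conv h f) = 0 := by
      have : inner ℂ f (T f) = 0 := by rw [h0]; simp
      rwa [show T f = P ((rightRep G).conv h (P f)) from rfl, ← hPs, hPf] at this
    have h2 : ‖inner ℂ f ((rightRep G).conv h f - f)‖ ≤ ‖f‖ * (‖f‖ / 2) :=
      (norm_inner_le_norm _ _).trans (by gcongr)
    rw [inner_sub_right, h1, zero_sub, norm_neg, inner_self_eq_norm_sq_to_K, norm_pow] at h2
    simp only [Complex.coe_algebraMap, Complex.norm_real, norm_norm] at h2
    nlinarith
  obtain ⟨c, hc, hc0⟩ : ∃ c, Module.End.HasEigenvalue (T : Module.End ℂ (L2 G)) c ∧ c ≠ 0 := by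
    by_contra! hcon
    exact hT0 ((ContinuousLinearMap.eq_zero_of_forall_hasEigenvalue_eq_zero hTc hTs).1 hcon)
  refine ⟨⟨Module.End.eigenspace (T : Module.End ℂ (L2 G)) c,
    ContinuousLinearMap.finite_dimensional_eigenspace hTc c hc0, fun g x hx => ?_,
    fun g x hx => ?_⟩, fun x hx => ?_, hc⟩
  · rw [Module.End.mem_eigenspace_iff] at hx ⊢
    exact (hTl g x).trans (by rw [← map_smul]; exact congrArg _ hx)
  · rw [Module.End.mem_eigenspace_iff] at hx ⊢
    exact (hTr g x).trans (by rw [← map_smul]; exact congrArg _ hx)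
  · rw [Module.End.mem_eigenspace_iff] at hx
    have h1 : c • x ∈ M := hx ▸ M.starProjection_apply_mem _
    exact (M.smul_mem_iff hc0).1 h1

variable (G) in
/-- `L²(G)` is the closed span of pairwise orthogonal blocks. -/
theorem exists_orthogonal_blocks : ∃ 𝒲 : Set (Block G),
    𝒲.Pairwise (fun V W => V.toSubmodule ⟂ W.toSubmodule) ∧
      (⨆ W : 𝒲, W.1.toSubmodule).topologicalClosure = ⊤ := by
  obtain ⟨𝒲, h𝒲⟩ := zorn_subset
    {𝒲 : Set (Block G) | 𝒲.Pairwise (fun V W => V.toSubmodule ⟂ W.toSubmodule)}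
    (fun c hc hchain => ⟨⋃₀ c, (Set.pairwise_sUnion hchain.directedOn).2 fun s hs => hc hs,
      fun s hs => Set.subset_sUnion_of_mem hs⟩)
  refine ⟨𝒲, h𝒲.prop, ?_⟩
  rw [← Submodule.orthogonal_orthogonal_eq_closure, Submodule.orthogonal_eq_top_iff]
  by_contra hne
  set S := ⨆ W : 𝒲, W.1.toSubmodule
  have inv (u : UnitaryRep G (L2 G)) (hu : ∀ W : Block G, ∀ g, ∀ f ∈ W.toSubmodule,
      u.op g f ∈ W.toSubmodule) : ∀ g, ∀ f ∈ Sᗮ, u.op g f ∈ Sᗮ := by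
    have hS (g : G) : S ≤ S.comap (u.op g).toLinearMap :=
      iSup_le fun W x hx => le_iSup (fun W : 𝒲 => W.1.toSubmodule) W (hu W.1 g x hx)
    intro g f hf
    refine (Submodule.mem_orthogonal' _ _).2 fun w hw => ?_
    rw [u.inner_op_left]
    exact (Submodule.mem_orthogonal' _ _).1 hf _ (hS g⁻¹ hw)
  obtain ⟨B, hB, hB0⟩ := exists_block_le hne (inv (leftRep G) fun W => W.leftReg_mem)
    (inv (rightRep G) fun W => W.rightReg_mem)
  have horth (W : Block G) (hW : W ∈ 𝒲) : B.toSubmodule ⟂ W.toSubmodule :=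
    hB.trans (Submodule.orthogonal_le (le_iSup (fun W : 𝒲 => W.1.toSubmodule) ⟨W, hW⟩))
  have hmem : B ∈ 𝒲 := by
    refine h𝒲.le_of_ge (y := insert B 𝒲) ?_ (Set.subset_insert B 𝒲) (Set.mem_insert B 𝒲)
    exact Set.pairwise_insert.2 ⟨h𝒲.prop, fun W hW _ => ⟨horth W hW, (horth W hW).symm⟩⟩
  exact hB0 (Submodule.isOrtho_self.1 (horth B hmem))

/-- The left regular representation on a block. -/
def Block.rep (B : Block G) : UnitaryRep G B.toSubmodule :=
  (leftRep G).restrict B.toSubmodule B.leftReg_mem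

/-- A finite-dimensional subspace meets only finitely many of a family of pairwise orthogonal
subspaces. -/
theorem finite_inf_ne_bot {H ι : Type*} [NormedAddCommGroup H] [InnerProductSpace ℂ H]
    (E : Submodule ℂ H) [FiniteDimensional ℂ E] {W : ι → Submodule ℂ H}
    (hW : Pairwise fun i j => W i ⟂ W j) : {i | E ⊓ W i ≠ ⊥}.Finite := by
  have h (i : {i | E ⊓ W i ≠ ⊥}) : ∃ x : E, (x : H) ∈ W i ∧ x ≠ 0 := by
    obtain ⟨x, hx, hx0⟩ := (Submodule.ne_bot_iff _).1 i.2
    exact ⟨⟨x, hx.1⟩, hx.2, fun h => hx0 congr(($h : H))⟩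
  choose x hxW hx0 using h
  have hli : LinearIndependent ℂ x := linearIndependent_of_ne_zero_of_inner_eq_zero hx0
    fun i j hij => (hW fun h => hij (Subtype.ext h)).inner_eq (hxW i) (hxW j)
  exact Set.finite_coe_iff.1 hli.finite

set_option maxHeartbeats 1000000 in
/-- A direct sum of blocks has finite multiplicities, if the different blocks in it are orthogonal
and every block occurs only finitely often. -/
theorem hasFiniteMultiplicities_directSum_blocks {J : Type*} (B : J → Block G)
    (horth : ∀ j k, B j ≠ B k → (B j).toSubmodule ⟂ (B k).toSubmodule)
    (hfib : ∀ b, {j | B j = b}.Finite) :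
    (UnitaryRep.directSum fun j => (B j).rep).HasFiniteMultiplicities := by
  intro n σ hσ
  obtain ⟨h, c, hc0, hc⟩ := exists_conv_eq_smul hσ
  -- The coordinates of an intertwiner from `σ` map into this eigenspace, which is
  -- finite-dimensional since convolution operators on `L²(G)` are compact.
  set E := Module.End.eigenspace ((leftRep G).conv h : Module.End ℂ (L2 G)) c
  have : FiniteDimensional ℂ E :=
    ContinuousLinearMap.finite_dimensional_eigenspace (isCompactOperator_conv h) c hc0
  have hJ : {j | E ⊓ (B j).toSubmodule ≠ ⊥}.Finite := by
    have h1 : {b : Set.range B | E ⊓ b.1.toSubmodule ≠ ⊥}.Finite := by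
      refine finite_inf_ne_bot E ?_
      rintro ⟨_, j, rfl⟩ ⟨_, k, rfl⟩ hjk
      exact horth j k fun h => hjk (Subtype.ext h)
    refine (h1.biUnion fun b _ => hfib b.1).subset fun j hj => ?_
    exact Set.mem_iUnion₂.2 ⟨⟨B j, j, rfl⟩, hj, rfl⟩
  have : Finite {j | E ⊓ (B j).toSubmodule ≠ ⊥} := hJ
  set μ := UnitaryRep.directSum fun j => (B j).rep
  let coord (j : J) : lp (fun j => (B j).toSubmodule) 2 →L[ℂ] L2 G :=
    (B j).toSubmodule.subtypeL ∘L lp.evalCLM ℂ _ 2 j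
  have hE (T : σ.multiplicitySpace μ) (j : J) (x) : coord j (T.1 x) ∈ E := by
    rw [Module.End.mem_eigenspace_iff]
    have hT (g : G) (x) : (coord j ∘L T.1) (σ.op g x) =
        (leftRep G).op g ((coord j ∘L T.1) x) := by
      have := congr($(T.2 g) x)
      simp only [ContinuousLinearMap.comp_apply] at this ⊢
      rw [this]
      rfl
    have := σ.conv_intertwine (leftRep G) h hT x
    rw [hc, map_smul] at this
    exact this.symm
  let Φ : σ.multiplicitySpace μ →ₗ[ℂ]
      {j | E ⊓ (B j).toSubmodule ≠ ⊥} → (EuclideanSpace ℂ (Fin n) →ₗ[ℂ] E) :=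
    { toFun := fun T j => LinearMap.codRestrict E (coord j ∘L T.1).toLinearMap (hE T j)
      map_add' := fun S T => by ext; rfl
      map_smul' := fun a T => by ext; rfl }
  refine Module.Finite.of_injective Φ fun S T hST => ?_
  rw [← sub_eq_zero]
  set D := S - T
  have hD : Φ D = 0 := by rw [map_sub, hST, sub_self]
  refine Subtype.ext (ContinuousLinearMap.ext fun x => ?_)
  ext j : 2
  by_cases hj : E ⊓ (B j).toSubmodule = ⊥
  · have hm : (coord j (D.1 x)) ∈ E ⊓ (B j).toSubmodule := ⟨hE D j x, Subtype.prop _⟩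
    rw [hj] at hm
    exact Subtype.ext hm
  · have := congr(($hD ⟨j, hj⟩ x : L2 G))
    exact Subtype.ext this

end Blocks

/-! ### Polar decomposition over a corner -/

section Polar

variable {X Y : Type*} [NormedAddCommGroup X] [InnerProductSpace ℂ X] [CompleteSpace X]
  [NormedAddCommGroup Y] [InnerProductSpace ℂ Y] [CompleteSpace Y]

/-- If `S` vanishes on the kernel of the projection `E` and is bounded below on its range, then
`S` has a polar decomposition with initial projection `E`: with `N = S* S + 1 - E` and
`M = N^(-1/2)`, the operator `S M` is a partial isometry. Moreover `M` lies in the C*-algebra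
generated by `N` and commutes with everything that `N` commutes with. -/
theorem exists_polar {S : X →L[ℂ] Y} {E : X →L[ℂ] X} (hE : IsStarProjection E) (hSE : S ∘L E = S)
    {C : ℝ} (hC : ∀ x, ‖E x‖ ≤ C * ‖S x‖) :
    ∃ M : X →L[ℂ] X, adjoint (S ∘L M) ∘L (S ∘L M) = E ∧
      (∀ R, Commute (adjoint S ∘L S + (1 - E)) R → Commute M R) ∧
      M ∈ StarAlgebra.elemental ℝ (adjoint S ∘L S + (1 - E)) := by
  set N : X →L[ℂ] X := adjoint S ∘L S + (1 - E) with hN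
  have hEs : adjoint E = E := hE.isSelfAdjoint
  have hEE (x : X) : E (E x) = E x := congr($(hE.isIdempotentElem) x)
  have hEn (x : X) : (inner ℂ (E x) x : ℂ) = (‖E x‖ ^ 2 : ℝ) := by
    rw [← hEE x, ← ContinuousLinearMap.adjoint_inner_right, hEs, inner_self_eq_norm_sq_to_K, hEE]
    norm_cast
  have hEle (x : X) : ‖E x‖ ^ 2 ≤ ‖x‖ ^ 2 := by
    have h1 : ‖E x‖ ^ 2 ≤ ‖E x‖ * ‖x‖ := by
      have := norm_inner_le_norm (𝕜 := ℂ) (E x) x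
      rw [hEn, Complex.norm_real, Real.norm_of_nonneg (by positivity)] at this
      exact this
    nlinarith [sq_nonneg (‖E x‖ - ‖x‖)]
  have hNinner (x : X) : (inner ℂ (N x) x : ℂ) = (‖S x‖ ^ 2 + ‖x‖ ^ 2 - ‖E x‖ ^ 2 : ℝ) := by
    simp only [hN, add_apply, sub_apply, ContinuousLinearMap.comp_apply, one_apply_eq_self,
      inner_add_left, inner_sub_left, ContinuousLinearMap.adjoint_inner_left, hEn,
      inner_self_eq_norm_sq_to_K]
    push_cast
    simp only [Complex.coe_algebraMap]
    ring
  set D : ℝ := max C 1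
  have hD : 1 ≤ D := le_max_right _ _
  have hDC (x : X) : ‖E x‖ ≤ D * ‖S x‖ :=
    (hC x).trans (mul_le_mul_of_nonneg_right (le_max_left _ _) (norm_nonneg _))
  have hd : 0 < (D ^ 2)⁻¹ := by positivity
  have hd1 : (D ^ 2)⁻¹ ≤ 1 := inv_le_one_of_one_le₀ (one_le_pow₀ hD)
  have hle : algebraMap ℝ (X →L[ℂ] X) (D ^ 2)⁻¹ ≤ N := by
    rw [ContinuousLinearMap.le_def, ContinuousLinearMap.isPositive_iff_complex]
    intro x
    have e : (inner ℂ ((N - algebraMap ℝ (X →L[ℂ] X) (D ^ 2)⁻¹) x) x : ℂ) =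
        (‖S x‖ ^ 2 + ‖x‖ ^ 2 - ‖E x‖ ^ 2 - (D ^ 2)⁻¹ * ‖x‖ ^ 2 : ℝ) := by
      rw [sub_apply, inner_sub_left, hNinner, Algebra.algebraMap_eq_smul_one, smul_apply,
        one_apply_eq_self, ← Complex.coe_smul, inner_smul_left, inner_self_eq_norm_sq_to_K]
      simp
    rw [e]
    refine ⟨by rw [RCLike.re_to_complex, Complex.ofReal_re], ?_⟩
    have h1 : (D ^ 2)⁻¹ * ‖E x‖ ^ 2 ≤ ‖S x‖ ^ 2 := by
      rw [inv_mul_le_iff₀ (by positivity), ← mul_pow]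
      exact pow_le_pow_left₀ (norm_nonneg _) (hDC x) 2
    have h2 := hEle x
    simp only [RCLike.re_to_complex, Complex.ofReal_re]
    nlinarith [mul_nonneg (sub_nonneg.2 hd1) (sub_nonneg.2 h2)]
  have hunit : IsUnit N := CStarAlgebra.isUnit_of_le _ hle (isStrictlyPositive_algebraMap hd)
  have hN0 : 0 ≤ N := (isStrictlyPositive_algebraMap (A := X →L[ℂ] X) hd).nonneg.trans hle
  set M : X →L[ℂ] X := N ^ (-(1 / 2) : ℝ)
  have hMs : adjoint M = M := IsSelfAdjoint.of_nonneg CFC.rpow_nonneg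
  have hMNM : M * N * M = 1 := by
    have h1 : N ^ (1 : ℝ) = N := CFC.rpow_one N
    have h2 : M * N ^ (1 : ℝ) * M = N ^ (-(1 / 2) + 1 + -(1 / 2) : ℝ) := by
      rw [CFC.rpow_add hunit, CFC.rpow_add hunit]
    rw [h1] at h2
    rw [h2, show (-(1 / 2) + 1 + -(1 / 2) : ℝ) = 0 by norm_num, CFC.rpow_zero N]
  have hcomm (R : X →L[ℂ] X) (hR : Commute N R) : Commute M R :=
    Commute.cfc_nnreal hR _
  have hES : E * (adjoint S ∘L S) = adjoint S ∘L S := by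
    have : adjoint (S ∘L E) = adjoint S := by rw [hSE]
    rw [ContinuousLinearMap.adjoint_comp, hEs] at this
    rw [ContinuousLinearMap.mul_def, ← ContinuousLinearMap.comp_assoc, this]
  have hSE' : (adjoint S ∘L S) * E = adjoint S ∘L S := by
    rw [ContinuousLinearMap.mul_def, ContinuousLinearMap.comp_assoc, hSE]
  have hE2 : E * E = E := hE.isIdempotentElem
  have hNE : N * E = adjoint S ∘L S := by
    rw [hN, add_mul, sub_mul, hSE', one_mul, hE2, sub_self, add_zero]
  have hEN : E * N = adjoint S ∘L S := by
    rw [hN, mul_add, mul_sub, hES, mul_one, hE2, sub_self, add_zero]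
  refine ⟨M, ?_, hcomm, ?_⟩
  · rw [ContinuousLinearMap.adjoint_comp, hMs]
    change M * (adjoint S ∘L S) * M = E
    have hME : Commute M E := hcomm E (hNE.trans hEN.symm)
    rw [← hEN, ← mul_assoc, hME.eq, mul_assoc, mul_assoc, ← mul_assoc M, hMNM, mul_one]
  · change N ^ (-(1 / 2) : ℝ) ∈ _
    rw [CFC.rpow_eq_cfc_real hN0]
    exact cfc_mem_elemental _ _

end Polar

section Elemental

variable {X Y : Type*} [NormedAddCommGroup X] [InnerProductSpace ℂ X] [CompleteSpace X]
  [NormedAddCommGroup Y] [InnerProductSpace ℂ Y]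

/-- A closed space of operators that is stable under composition with a self-adjoint `N` is stable
under composition with the elements of the C*-algebra generated by `N`. -/
theorem comp_mem_of_mem_elemental {𝒮 : Submodule ℂ (X →L[ℂ] Y)}
    (h𝒮 : IsClosed (𝒮 : Set (X →L[ℂ] Y))) {N M : X →L[ℂ] X} (hN : IsSelfAdjoint N)
    (hN𝒮 : ∀ S ∈ 𝒮, S ∘L N ∈ 𝒮) (hM : M ∈ StarAlgebra.elemental ℝ N) {S : X →L[ℂ] Y}
    (hS : S ∈ 𝒮) : S ∘L M ∈ 𝒮 := by
  let 𝔅 : StarSubalgebra ℝ (X →L[ℂ] X) :=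
    { carrier := {Z | ∀ S ∈ 𝒮, S ∘L Z ∈ 𝒮 ∧ S ∘L star Z ∈ 𝒮}
      mul_mem' := fun {Z Z'} hZ hZ' S hS => by
        rw [star_mul]
        exact ⟨(hZ' _ (hZ S hS).1).1, (hZ _ (hZ' S hS).2).2⟩
      add_mem' := fun {Z Z'} hZ hZ' S hS => by
        rw [star_add, ContinuousLinearMap.comp_add, ContinuousLinearMap.comp_add]
        exact ⟨add_mem (hZ S hS).1 (hZ' S hS).1, add_mem (hZ S hS).2 (hZ' S hS).2⟩
      algebraMap_mem' := fun r S hS => by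
        have h1 : S ∘L (r • (1 : X →L[ℂ] X)) = (r : ℂ) • S := by
          ext x; simp
        rw [Algebra.algebraMap_eq_smul_one, star_smul, star_one, star_trivial, h1]
        exact ⟨Submodule.smul_mem _ _ hS, Submodule.smul_mem _ _ hS⟩
      star_mem' := fun {Z} hZ S hS => by
        rw [star_star]; exact (hZ S hS).symm }
  have hcl : IsClosed {Z : X →L[ℂ] X | ∀ S ∈ 𝒮, S ∘L Z ∈ 𝒮 ∧ S ∘L star Z ∈ 𝒮} := by
    simp only [Set.ofPred_forall, Set.ofPred_and]
    refine isClosed_iInter fun S => isClosed_iInter fun _ => IsClosed.inter ?_ ?_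
    · exact h𝒮.preimage (continuous_const.clm_comp continuous_id)
    · exact h𝒮.preimage (continuous_const.clm_comp (continuous_star (R := X →L[ℂ] X)))
  have hN𝔅 : N ∈ 𝔅 := fun S hS => by
    rw [hN.star_eq]; exact ⟨hN𝒮 S hS, hN𝒮 S hS⟩
  have h1 : M ∈ 𝔅 := StarAlgebra.elemental.le_of_mem hcl hN𝔅 hM
  exact (h1 S hS).1

end Elemental

/-! ### The partial isometry attached to a block -/

section CovariantRep

variable {A G : Type*} [CStarAlgebra A] [Group G] [TopologicalSpace G]
variable {α : CStarDynSystem A G}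
variable {HA : Type*} [NormedAddCommGroup HA] [InnerProductSpace ℂ HA] [CompleteSpace HA]
variable {π : A →⋆ₐ[ℂ] (HA →L[ℂ] HA)} {u : UnitaryRep G HA}

theorem IsFaithfulCovariantRep.isometry (h : IsFaithfulCovariantRep α π u) : Isometry π :=
  NonUnitalStarAlgHom.isometry π h.1

theorem IsFaithfulCovariantRep.norm_apply (h : IsFaithfulCovariantRep α π u) (a : A) :
    ‖π a‖ = ‖a‖ :=
  h.isometry.norm_map_of_map_zero (map_zero π) a

theorem IsFaithfulCovariantRep.op_comp (h : IsFaithfulCovariantRep α π u) (g : G) (a : A) :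
    u.op g ∘L π a = π (α.act g a) ∘L u.op g := by
  rw [← h.2 g a]
  ext x
  simp [ContinuousLinearMap.star_eq_adjoint, u.adjoint_op]

end CovariantRep

section Block

variable {G : Type*} [Group G] [TopologicalSpace G] [IsTopologicalGroup G] [CompactSpace G]
  [MeasurableSpace G] [BorelSpace G]

/-- The orthogonal projection onto a block. -/
def Block.proj (B : Block G) : L2 G →L[ℂ] B.toSubmodule := B.toSubmodule.orthogonalProjectionOnto

theorem Block.proj_comp_starProjection (B : Block G) :
    B.proj ∘L B.toSubmodule.starProjection = B.proj := by
  ext x : 1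
  exact Submodule.orthogonalProjectionOnto_mem_subspace_eq_self _

variable [T2Space G]

theorem Block.proj_leftReg (B : Block G) (g : G) (x : L2 G) :
    B.proj (leftReg g x) = B.rep.op g (B.proj x) :=
  Subtype.ext ((leftRep G).starProjection_op B.toSubmodule B.leftReg_mem g x)

theorem Block.continuous_proj_comp_rightReg (B : Block G) :
    Continuous fun g => B.proj ∘L rightReg g⁻¹ := by
  have h1 : Continuous fun g => rightReg g ∘L B.toSubmodule.subtypeL :=
    continuous_clm_apply.2 fun x => (rightRep G).continuous_apply x
  have h2 (g : G) : adjoint (rightReg g ∘L B.toSubmodule.subtypeL) = B.proj ∘L rightReg g⁻¹ := by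
    rw [ContinuousLinearMap.adjoint_comp, Submodule.adjoint_subtypeL]
    exact congrArg _ ((rightRep G).adjoint_op g)
  simp only [← h2]
  exact (adjoint (𝕜 := ℂ) (E := B.toSubmodule) (F := L2 G)).continuous.comp h1

theorem Block.norm_proj_comp_rightReg_le (B : Block G) (g : G) :
    ‖B.proj ∘L rightReg g⁻¹‖ ≤ 1 :=
  (ContinuousLinearMap.opNorm_comp_le _ _).trans (mul_le_one₀
    B.toSubmodule.orthogonalProjectionOnto_norm_le (norm_nonneg _) ((rightRep G).norm_op_le g⁻¹))

variable {A : Type*} [CStarAlgebra A] {α : CStarDynSystem A G}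

/-- Freeness provides elements `x_k`, `y_k` of `A` such that `g ↦ ∑ x_k α_g(y_k)` is close to
an approximate identity which almost fixes the block. -/
theorem CStarDynSystem.IsFree.exists_mollifier_finset (hα : α.IsFree) (B : Block G) :
    ∃ (m : Mollifier G) (S : Finset (A × A)),
      ‖∫ g, m g • (B.proj ∘L rightReg g⁻¹) ∂haarProb G - B.proj‖ ≤ 1 / 4 ∧
      ∀ g, ‖∑ k : S, k.1.1 * α.act g k.1.2 - m g • (1 : A)‖ ≤ 1 / 4 := by
  obtain ⟨m, hm⟩ := exists_mollifier (E := L2 G →L[ℂ] B.toSubmodule)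
    B.continuous_proj_comp_rightReg (by norm_num : (0 : ℝ) < 1 / 4)
  have h1 : B.proj ∘L rightReg (1 : G)⁻¹ = B.proj := by
    ext1 x
    rw [inv_one]
    exact congrArg B.proj ((rightRep G).op_one_apply x)
  rw [h1] at hm
  let F : C(G, A) := ⟨fun g => m g • 1, m.continuous_smul continuous_const⟩
  obtain ⟨_, ⟨z, rfl⟩, hz⟩ := Metric.mem_closure_iff.1 (hα F) (1 / 4) (by norm_num)
  obtain ⟨S, rfl⟩ := TensorProduct.exists_finset z
  refine ⟨m, S, hm, fun g => ?_⟩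
  rw [dist_comm, dist_eq_norm] at hz
  refine le_trans (le_of_eq ?_) (((_ : C(G, A)).norm_coe_le_norm g).trans hz.le)
  rw [Finset.sum_coe_sort S fun k => k.1 * α.act g k.2, map_sum, ContinuousMap.sub_apply,
    ContinuousMap.sum_apply]
  rfl

end Block

section Integral

variable {G : Type*} [Group G] [TopologicalSpace G] [IsTopologicalGroup G] [CompactSpace G]
  [MeasurableSpace G] [BorelSpace G]

theorem comp_integral_haarProb {X Y Z : Type*} [NormedAddCommGroup X] [NormedSpace ℂ X]
    [NormedAddCommGroup Y] [NormedSpace ℂ Y] [CompleteSpace Y] [NormedAddCommGroup Z]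
    [NormedSpace ℂ Z] [CompleteSpace Z] (T : Y →L[ℂ] Z) {f : G → X →L[ℂ] Y}
    (hf : Continuous f) : T ∘L ∫ g, f g ∂haarProb G = ∫ g, T ∘L f g ∂haarProb G :=
  ((ContinuousLinearMap.compL ℂ X Y Z T).integral_comp_comm (integrable_haarProb hf)).symm

theorem integral_haarProb_comp {X Y Z : Type*} [NormedAddCommGroup X] [NormedSpace ℂ X]
    [NormedAddCommGroup Y] [NormedSpace ℂ Y] [CompleteSpace Y] [NormedAddCommGroup Z]
    [NormedSpace ℂ Z] (T : Z →L[ℂ] X) {f : G → X →L[ℂ] Y}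
    (hf : Continuous f) : (∫ g, f g ∂haarProb G) ∘L T = ∫ g, f g ∘L T ∂haarProb G :=
  (((ContinuousLinearMap.compL ℂ Z X Y).flip T).integral_comp_comm (integrable_haarProb hf)).symm

theorem opTensor_integral_right {E F K L : Type*} [NormedAddCommGroup E] [InnerProductSpace ℂ E]
    [NormedAddCommGroup F] [InnerProductSpace ℂ F] [NormedAddCommGroup K] [InnerProductSpace ℂ K]
    [NormedAddCommGroup L] [InnerProductSpace ℂ L] [CompleteSpace L] (S : E →L[ℂ] F)
    {f : G → K →L[ℂ] L} (hf : Continuous f) :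
    opTensor S (∫ g, f g ∂haarProb G) = ∫ g, opTensor S (f g) ∂haarProb G :=
  ((opTensorL E F K L S).integral_comp_comm (integrable_haarProb hf)).symm

end Integral

section BlockIsometry

variable {G : Type*} [Group G] [TopologicalSpace G] [IsTopologicalGroup G] [CompactSpace G]
  [MeasurableSpace G] [BorelSpace G]
variable {A : Type*} [CStarAlgebra A] {α : CStarDynSystem A G}
variable {HA : Type*} [NormedAddCommGroup HA] [InnerProductSpace ℂ HA] [CompleteSpace HA]
variable {π : A →⋆ₐ[ℂ] (HA →L[ℂ] HA)} {u : UnitaryRep G HA}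
variable {H : Type*} [NormedAddCommGroup H] [InnerProductSpace ℂ H]

variable (α π) in
/-- The integrand `g ↦ π(α_g(y)) ⊗ ι P_B r_g⁻¹`. -/
def blockKernel (B : Block G) (y : A) (ι : B.toSubmodule →L[ℂ] H) (g : G) :
    HilbertTensor HA (L2 G) →L[ℂ] HilbertTensor HA H :=
  opTensor (π (α.act g y)) (ι ∘L B.proj ∘L rightReg g⁻¹)

variable (α π) in
/-- The operator `∑ₖ ∫ π(α_g(y_k)) ⊗ ι_k P_B r_g⁻¹ dg`. -/
def blockOp (B : Block G) (F : Finset (A × A)) (ι : F → B.toSubmodule →L[ℂ] H) :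
    HilbertTensor HA (L2 G) →L[ℂ] HilbertTensor HA H :=
  ∑ k, ∫ g, blockKernel α π B k.1.2 (ι k) g ∂haarProb G

/-- With `ι_k* ι_l = δ_kl`, the operator `∑ π(x_k) ⊗ ι_k*` turns the integrand of
`∑ ∫ π(α_g(y_k)) ⊗ ι_k P_B r_g⁻¹ dg` into `π(∑ x_k α_g(y_k)) ⊗ P_B r_g⁻¹`. -/
theorem sum_comp_blockKernel [CompleteSpace H] {B : Block G} {F : Finset (A × A)}
    {ι : F → B.toSubmodule →L[ℂ] H}
    (hι : ∀ k, adjoint (ι k) ∘L ι k = ContinuousLinearMap.id ℂ B.toSubmodule)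
    (hι' : ∀ k l, k ≠ l → adjoint (ι k) ∘L ι l = 0) (g : G) :
    ∑ l, (∑ k : F, opTensor (π k.1.1) (adjoint (ι k))) ∘L blockKernel α π B l.1.2 (ι l) g =
      opTensor (π (∑ k : F, k.1.1 * α.act g k.1.2)) (B.proj ∘L rightReg g⁻¹) := by
  classical
  have h1 (k l : F) : opTensor (π k.1.1) (adjoint (ι k)) ∘L blockKernel α π B l.1.2 (ι l) g =
      if k = l then opTensor (π (k.1.1 * α.act g k.1.2)) (B.proj ∘L rightReg g⁻¹) else 0 := by
    rw [blockKernel, opTensor_comp, ← ContinuousLinearMap.comp_assoc (adjoint (ι k))]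
    split_ifs with hkl
    · subst hkl
      rw [hι, ContinuousLinearMap.id_comp, map_mul]; rfl
    · rw [hι' k l hkl, ContinuousLinearMap.zero_comp, opTensor_zero_right]
  rw [map_sum, opTensor_sum_left]
  refine Finset.sum_congr rfl fun l _ => ?_
  simp only [ContinuousLinearMap.finsetSum_comp, h1, Finset.sum_ite_eq', Finset.mem_univ, if_true]

variable [T2Space G]

theorem continuous_blockKernel (h : IsFaithfulCovariantRep α π u) (B : Block G) (y : A)
    (ι : B.toSubmodule →L[ℂ] H) : Continuous (blockKernel α π B y ι) :=
  continuous_opTensor (h.isometry.continuous.comp (α.continuous_orbit _))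
    (continuous_const.clm_comp B.continuous_proj_comp_rightReg)

theorem comp_blockOp (h : IsFaithfulCovariantRep α π u) {B : Block G} {F : Finset (A × A)}
    {ι : F → B.toSubmodule →L[ℂ] H} {Z : Type*} [NormedAddCommGroup Z] [NormedSpace ℂ Z]
    [CompleteSpace Z] (T : HilbertTensor HA H →L[ℂ] Z) :
    T ∘L blockOp α π B F ι = ∑ k, ∫ g, T ∘L blockKernel α π B k.1.2 (ι k) g ∂haarProb G := by
  rw [blockOp, ContinuousLinearMap.comp_finsetSum]
  exact Finset.sum_congr rfl fun k _ =>
    comp_integral_haarProb T (continuous_blockKernel h B k.1.2 (ι k))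

theorem blockOp_comp (h : IsFaithfulCovariantRep α π u) {B : Block G} {F : Finset (A × A)}
    {ι : F → B.toSubmodule →L[ℂ] H} (R : HilbertTensor HA (L2 G) →L[ℂ] HilbertTensor HA (L2 G)) :
    blockOp α π B F ι ∘L R = ∑ k, ∫ g, blockKernel α π B k.1.2 (ι k) g ∘L R ∂haarProb G := by
  rw [blockOp, ContinuousLinearMap.finsetSum_comp]
  exact Finset.sum_congr rfl fun k _ =>
    integral_haarProb_comp R (continuous_blockKernel h B k.1.2 (ι k))

variable [CompleteSpace H] {μ : UnitaryRep G H}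

/-- The operator `∑ π(x_k) ⊗ ι_k*` is an approximate left inverse of `blockOp` on the block, since
`∑ x_k α_g(y_k)` is close to `m(g)` and `∫ m(g) P_B r_g⁻¹ dg` is close to `P_B`. -/
theorem norm_comp_blockOp_sub_le {B : Block G} {m : Mollifier G} {F : Finset (A × A)}
    (hm : ‖∫ g, m g • (B.proj ∘L rightReg g⁻¹) ∂haarProb G - B.proj‖ ≤ 1 / 4)
    (hF : ∀ g, ‖∑ k : F, k.1.1 * α.act g k.1.2 - m g • (1 : A)‖ ≤ 1 / 4)
    {ι : F → B.toSubmodule →L[ℂ] H}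
    (hι : ∀ k, adjoint (ι k) ∘L ι k = ContinuousLinearMap.id ℂ B.toSubmodule)
    (hι' : ∀ k l, k ≠ l → adjoint (ι k) ∘L ι l = 0) (h : IsFaithfulCovariantRep α π u) :
    ‖(∑ k : F, opTensor (π k.1.1) (adjoint (ι k))) ∘L blockOp α π B F ι -
      opTensor (ContinuousLinearMap.id ℂ HA) B.proj‖ ≤ 1 / 2 := by
  set I := ContinuousLinearMap.id ℂ HA
  set T : HilbertTensor HA H →L[ℂ] HilbertTensor HA B.toSubmodule :=
    ∑ k : F, opTensor (π k.1.1) (adjoint (ι k)) with hT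
  set Q : G → L2 G →L[ℂ] B.toSubmodule := fun g => B.proj ∘L rightReg g⁻¹
  have hQ : Continuous Q := B.continuous_proj_comp_rightReg
  have hmQ' : Continuous fun g => m g • Q g :=
    m.continuous_smul (E := L2 G →L[ℂ] B.toSubmodule) hQ
  have hmQ : Continuous fun g => opTensor I (m g • Q g) :=
    continuous_opTensor continuous_const hmQ'
  have hJ (k : F) : Continuous fun g => T ∘L blockKernel α π B k.1.2 (ι k) g :=
    continuous_const.clm_comp (continuous_blockKernel h B k.1.2 (ι k))
  have e1 : T ∘L blockOp α π B F ι - opTensor I (∫ g, m g • Q g ∂haarProb G) =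
      ∫ g, (∑ l : F, T ∘L blockKernel α π B l.1.2 (ι l) g - opTensor I (m g • Q g))
        ∂haarProb G := by
    rw [integral_sub (integrable_haarProb (continuous_finsetSum _ fun l _ => hJ l))
      (integrable_haarProb hmQ), comp_blockOp h,
      integral_finsetSum _ fun l _ => integrable_haarProb (hJ l)]
    congr 1
    exact opTensor_integral_right I hmQ'
  have e2 (g : G) : ∑ l : F, T ∘L blockKernel α π B l.1.2 (ι l) g - opTensor I (m g • Q g) =
      opTensor (π (∑ k : F, k.1.1 * α.act g k.1.2 - m g • (1 : A))) (Q g) := by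
    have e3 : opTensor I (m g • Q g) = opTensor (π (m g • (1 : A))) (Q g) := by
      have e4 : π (m g • (1 : A)) = (m g : ℂ) • I := by
        rw [← Complex.coe_smul, map_smul, map_one]; rfl
      rw [e4, opTensor_smul_left, ← opTensor_smul_right, Complex.coe_smul]
      rfl
    rw [hT, sum_comp_blockKernel hι hι', e3, map_sub, opTensor_sub_left]
  have n1 : ‖T ∘L blockOp α π B F ι - opTensor I (∫ g, m g • Q g ∂haarProb G)‖ ≤ 1 / 4 := by
    rw [e1]
    refine norm_integral_haarProb_le fun g => ?_
    rw [e2]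
    refine (norm_opTensor_le _ _).trans ?_
    rw [h.norm_apply]
    exact (mul_le_mul (hF g) (B.norm_proj_comp_rightReg_le g)
      (ContinuousLinearMap.opNorm_nonneg _) (by norm_num)).trans (by norm_num)
  have n2 : ‖opTensor I (∫ g, m g • Q g ∂haarProb G) - opTensor I B.proj‖ ≤ 1 / 4 := by
    rw [← opTensor_sub_right]
    refine (norm_opTensor_le _ _).trans ?_
    exact (mul_le_mul ContinuousLinearMap.norm_id_le hm (ContinuousLinearMap.opNorm_nonneg _)
      zero_le_one).trans (by norm_num)
  refine (norm_sub_le_norm_sub_add_norm_sub _ _ _).trans ((add_le_add n1 n2).trans ?_)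
  norm_num

/-- The operator `blockOp` is bounded below on the block. -/
theorem exists_norm_le_blockOp {B : Block G} {m : Mollifier G} {F : Finset (A × A)}
    (hm : ‖∫ g, m g • (B.proj ∘L rightReg g⁻¹) ∂haarProb G - B.proj‖ ≤ 1 / 4)
    (hF : ∀ g, ‖∑ k : F, k.1.1 * α.act g k.1.2 - m g • (1 : A)‖ ≤ 1 / 4)
    {ι : F → B.toSubmodule →L[ℂ] H}
    (hι : ∀ k, adjoint (ι k) ∘L ι k = ContinuousLinearMap.id ℂ B.toSubmodule)
    (hι' : ∀ k l, k ≠ l → adjoint (ι k) ∘L ι l = 0) (h : IsFaithfulCovariantRep α π u)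
    (hSE : blockOp α π B F ι ∘L opTensor (ContinuousLinearMap.id ℂ HA)
      B.toSubmodule.starProjection = blockOp α π B F ι) :
    ∃ C : ℝ, ∀ x, ‖opTensor (ContinuousLinearMap.id ℂ HA) B.toSubmodule.starProjection x‖ ≤
      C * ‖blockOp α π B F ι x‖ := by
  have hTS := norm_comp_blockOp_sub_le hm hF hι hι' h
  set I := ContinuousLinearMap.id ℂ HA
  set E := opTensor I B.toSubmodule.starProjection with hE
  set S := blockOp α π B F ι
  set T : HilbertTensor HA H →L[ℂ] HilbertTensor HA B.toSubmodule :=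
    ∑ k : F, opTensor (π k.1.1) (adjoint (ι k))
  refine ⟨2 * ‖T‖, fun x => ?_⟩
  have hEx : opTensor I B.proj (E x) = opTensor I B.proj x := by
    rw [hE, ← ContinuousLinearMap.comp_apply, opTensor_comp, B.proj_comp_starProjection]; rfl
  have hEx2 : E x = opTensor I B.toSubmodule.subtypeL (opTensor I B.proj x) := by
    rw [hE, ← ContinuousLinearMap.comp_apply, opTensor_comp]; rfl
  have n3 : ‖E x‖ ≤ ‖opTensor I B.proj x‖ := by
    rw [hEx2]
    refine (ContinuousLinearMap.le_of_opNorm_le _ ((norm_opTensor_le _ _).trans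
      (mul_le_one₀ ContinuousLinearMap.norm_id_le (norm_nonneg _)
        (Submodule.norm_subtypeL_le _))) _).trans (by rw [one_mul])
  have n4 : ‖T (S x) - opTensor I B.proj x‖ ≤ 1 / 2 * ‖E x‖ := by
    have := (T ∘L S - opTensor I B.proj).le_of_opNorm_le hTS (E x)
    rw [sub_apply, ContinuousLinearMap.comp_apply, hEx] at this
    rwa [show S (E x) = S x from congr($hSE x)] at this
  have n5 : ‖opTensor I B.proj x‖ ≤ ‖T (S x)‖ + ‖T (S x) - opTensor I B.proj x‖ :=
    norm_le_norm_add_norm_sub _ _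
  have n6 := T.le_opNorm (S x)
  linarith

/-- If `S` intertwines two pairs of mutually adjoint operators, then `S* S` commutes with the first
operator. -/
theorem commute_adjoint_comp_self {X Y : Type*} [NormedAddCommGroup X] [InnerProductSpace ℂ X]
    [CompleteSpace X] [NormedAddCommGroup Y] [InnerProductSpace ℂ Y] [CompleteSpace Y]
    {S : X →L[ℂ] Y} {R R' : X →L[ℂ] X} {U U' : Y →L[ℂ] Y} (hR : adjoint R' = R)
    (hU : adjoint U' = U) (h : U ∘L S = S ∘L R) (h' : U' ∘L S = S ∘L R') :
    Commute (adjoint S ∘L S) R := by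
  have h2 : adjoint S ∘L U = R ∘L adjoint S := by
    rw [← hU, ← hR, ← ContinuousLinearMap.adjoint_comp, h', ContinuousLinearMap.adjoint_comp]
  change (adjoint S ∘L S) ∘L R = R ∘L adjoint S ∘L S
  rw [ContinuousLinearMap.comp_assoc, ← h, ← ContinuousLinearMap.comp_assoc, h2,
    ContinuousLinearMap.comp_assoc]

/-- For a block `B`, the partial isometry `s` with initial projection `1 ⊗ P_B` and with the
intertwining properties of the theorem. It is obtained by polar decomposition from
`∑ₖ ∫ π(α_g(y_k)) ⊗ ι_k P_B r_g⁻¹ dg`. -/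
theorem exists_block_isometry {B : Block G} {m : Mollifier G} {F : Finset (A × A)}
    (hm : ‖∫ g, m g • (B.proj ∘L rightReg g⁻¹) ∂haarProb G - B.proj‖ ≤ 1 / 4)
    (hF : ∀ g, ‖∑ k : F, k.1.1 * α.act g k.1.2 - m g • (1 : A)‖ ≤ 1 / 4)
    {ι : F → B.toSubmodule →L[ℂ] H}
    (hι : ∀ k, adjoint (ι k) ∘L ι k = ContinuousLinearMap.id ℂ B.toSubmodule)
    (hι' : ∀ k l, k ≠ l → adjoint (ι k) ∘L ι l = 0)
    (hιμ : ∀ k g x, ι k (B.rep.op g x) = μ.op g (ι k x))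
    (h : IsFaithfulCovariantRep α π u) :
    ∃ s : HilbertTensor HA (L2 G) →L[ℂ] HilbertTensor HA H,
      s ∈ compactTensor π (L2 G) H ∧
      adjoint s ∘L s = opTensor (ContinuousLinearMap.id ℂ HA) B.toSubmodule.starProjection ∧
      (∀ g, opTensor (u.op g) (ContinuousLinearMap.id ℂ H) ∘L s =
        s ∘L opTensor (u.op g) (rightReg g)) ∧
      (∀ g, opTensor (ContinuousLinearMap.id ℂ HA) (μ.op g) ∘L s =
        s ∘L opTensor (ContinuousLinearMap.id ℂ HA) (leftReg g)) ∧
      ∀ T : H →L[ℂ] H, (∀ k, T ∘L ι k = 0) →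
        opTensor (ContinuousLinearMap.id ℂ HA) T ∘L s = 0 := by
  set I := ContinuousLinearMap.id ℂ HA
  set P := B.toSubmodule.starProjection
  have hπ1 : π 1 = I := map_one π
  set S : HilbertTensor HA (L2 G) →L[ℂ] HilbertTensor HA H := blockOp α π B F ι
  have hPr (g : G) (x : L2 G) : P (rightReg g x) = rightReg g (P x) :=
    (rightRep G).starProjection_op B.toSubmodule B.rightReg_mem g x
  have hPl (g : G) (x : L2 G) : P (leftReg g x) = leftReg g (P x) :=
    (leftRep G).starProjection_op B.toSubmodule B.leftReg_mem g x
  have hadj : adjoint P = P := (isSelfAdjoint_starProjection B.toSubmodule)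
  have hPP : P ∘L P = P := B.toSubmodule.isIdempotentElem_starProjection
  set E : HilbertTensor HA (L2 G) →L[ℂ] HilbertTensor HA (L2 G) := opTensor I P with hE
  have hEproj : IsStarProjection E := by
    refine ⟨?_, ?_⟩
    · change opTensor I P ∘L opTensor I P = _
      rw [opTensor_comp, hPP]; rfl
    · change adjoint (opTensor I P) = _
      rw [adjoint_opTensor, hadj, ContinuousLinearMap.adjoint_id]
  have hSE : S ∘L E = S := by
    rw [blockOp_comp h]
    refine Finset.sum_congr rfl fun k _ => ?_
    congr 1
    funext g
    have : (ι k ∘L B.proj ∘L rightReg g⁻¹) ∘L P = ι k ∘L B.proj ∘L rightReg g⁻¹ := by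
      ext x
      simp only [ContinuousLinearMap.comp_apply]
      rw [← hPr]
      exact congrArg _ congr($(B.proj_comp_starProjection) _)
    rw [hE, blockKernel, opTensor_comp, this]; rfl
  have hSu (g : G) : opTensor (u.op g) (ContinuousLinearMap.id ℂ H) ∘L S =
      S ∘L opTensor (u.op g) (rightReg g) := by
    rw [comp_blockOp h, blockOp_comp h]
    refine Finset.sum_congr rfl fun k _ => ?_
    rw [← integral_mul_left_eq_self
      (fun x => blockKernel α π B k.1.2 (ι k) x ∘L opTensor (u.op g) (rightReg g)) g]
    congr 1
    funext x
    have hact : α.act (g * x) k.1.2 = α.act g (α.act x k.1.2) := by rw [map_mul]; rfl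
    simp only [blockKernel, opTensor_comp, h.op_comp, hact]
    congr 1
    ext1 f
    have hr : rightReg (g * x)⁻¹ (rightReg g f) = rightReg x⁻¹ f := by
      have := (rightRep G).op_mul_apply (g * x)⁻¹ g f
      rw [show (g * x)⁻¹ * g = x⁻¹ by group] at this
      exact this.symm
    simp only [ContinuousLinearMap.comp_apply, hr, ContinuousLinearMap.id_apply]
  have hSμ (g : G) : opTensor I (μ.op g) ∘L S = S ∘L opTensor I (leftReg g) := by
    rw [comp_blockOp h, blockOp_comp h]
    refine Finset.sum_congr rfl fun k _ => ?_
    congr 1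
    funext x
    simp only [blockKernel, opTensor_comp]
    congr 1
    ext1 f
    simp only [ContinuousLinearMap.comp_apply]
    rw [← leftReg_rightReg, B.proj_leftReg, hιμ]
  have hSmem : S ∈ compactTensor π (L2 G) H := by
    refine Submodule.sum_mem _ fun k _ => integral_haarProb_mem (isClosed_compactTensor π)
      (continuous_blockKernel h B k.1.2 (ι k))
      fun g => opTensor_mem_compactTensor (isCompactOperator_of_factor _ _) _
  obtain ⟨C, hC⟩ := exists_norm_le_blockOp hm hF hι hι' h hSE
  obtain ⟨M, hM1, hM2, hM3⟩ := exists_polar hEproj hSE hC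
  have hEmem : E ∈ compactTensor π (L2 G) (L2 G) := by
    rw [hE, ← hπ1]
    exact opTensor_mem_compactTensor
      (isCompactOperator_of_factor B.toSubmodule.subtypeL B.proj) _
  have hSSmem : adjoint S ∘L S ∈ compactTensor π (L2 G) (L2 G) :=
    comp_mem_compactTensor (adjoint_mem_compactTensor hSmem) hSmem
  have hNR {R R' : HilbertTensor HA (L2 G) →L[ℂ] HilbertTensor HA (L2 G)}
      {U U' : HilbertTensor HA H →L[ℂ] HilbertTensor HA H} (hR : adjoint R' = R)
      (hU : adjoint U' = U) (h : U ∘L S = S ∘L R) (h' : U' ∘L S = S ∘L R') (hER : Commute E R) :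
      U ∘L (S ∘L M) = (S ∘L M) ∘L R := by
    have h1 : Commute M R := hM2 R ((commute_adjoint_comp_self hR hU h h').add_left
      ((Commute.one_left R).sub_left hER))
    have h2 : M ∘L R = R ∘L M := h1
    rw [← ContinuousLinearMap.comp_assoc, h, ContinuousLinearMap.comp_assoc,
      ContinuousLinearMap.comp_assoc, h2]
  refine ⟨S ∘L M, ?_, hM1, fun g => ?_, fun g => ?_, fun T hT => ?_⟩
  · refine comp_mem_of_mem_elemental (isClosed_compactTensor π) ?_ (fun Y hY => ?_) hM3 hSmem
    · have hSS : IsSelfAdjoint (adjoint S ∘L S) := by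
        change adjoint (adjoint S ∘L S) = _
        rw [ContinuousLinearMap.adjoint_comp, ContinuousLinearMap.adjoint_adjoint]
      exact hSS.add ((IsSelfAdjoint.one _).sub hEproj.isSelfAdjoint)
    · have : Y ∘L (adjoint S ∘L S + (1 - E)) = Y ∘L (adjoint S ∘L S) + (Y - Y ∘L E) := by
        ext x; simp
      rw [this]
      exact add_mem (comp_mem_compactTensor hY hSSmem)
        (sub_mem hY (comp_mem_compactTensor hY hEmem))
  · refine hNR (R' := opTensor (u.op g⁻¹) (rightReg g⁻¹))
      (U' := opTensor (u.op g⁻¹) (ContinuousLinearMap.id ℂ H)) ?_ ?_ (hSu g) (hSu g⁻¹) ?_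
    · rw [adjoint_opTensor, u.adjoint_op, inv_inv]
      exact congrArg _ (((rightRep G).adjoint_op g⁻¹).trans (by rw [inv_inv]; rfl))
    · rw [adjoint_opTensor, u.adjoint_op, inv_inv, ContinuousLinearMap.adjoint_id]
    · change opTensor I P ∘L opTensor (u.op g) (rightReg g) =
        opTensor (u.op g) (rightReg g) ∘L opTensor I P
      rw [opTensor_comp, opTensor_comp]
      exact congrArg (opTensor (u.op g)) (ContinuousLinearMap.ext (hPr g))
  · refine hNR (R' := opTensor I (leftReg g⁻¹)) (U' := opTensor I (μ.op g⁻¹)) ?_ ?_ (hSμ g)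
      (hSμ g⁻¹) ?_
    · rw [adjoint_opTensor, ContinuousLinearMap.adjoint_id]
      exact congrArg _ (((leftRep G).adjoint_op g⁻¹).trans (by rw [inv_inv]; rfl))
    · rw [adjoint_opTensor, μ.adjoint_op, inv_inv, ContinuousLinearMap.adjoint_id]
    · change opTensor I P ∘L opTensor I (leftReg g) = opTensor I (leftReg g) ∘L opTensor I P
      rw [opTensor_comp, opTensor_comp]
      exact congrArg (opTensor I) (ContinuousLinearMap.ext (hPl g))
  · rw [← ContinuousLinearMap.comp_assoc, comp_blockOp h, Finset.sum_eq_zero fun k _ => ?_,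
      ContinuousLinearMap.zero_comp]
    have (g : G) : opTensor I T ∘L blockKernel α π B k.1.2 (ι k) g = 0 := by
      simp only [blockKernel, opTensor_comp]
      rw [← ContinuousLinearMap.comp_assoc T, hT, ContinuousLinearMap.zero_comp,
        opTensor_zero_right]
    simp only [this, integral_zero]

end BlockIsometry

/-! ### Gluing partial isometries -/

section Gluing

variable {X Y : Type*} [NormedAddCommGroup X] [InnerProductSpace ℂ X] [CompleteSpace X]
  [NormedAddCommGroup Y] [InnerProductSpace ℂ Y] [CompleteSpace Y]

/-- Partial isometries with orthogonal ranges, whose initial projections are orthogonal and have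
dense linear span, are the restrictions of one isometry. -/
theorem exists_isometry_of_orthogonal {ι : Type*} {E : ι → X →L[ℂ] X} {s : ι → X →L[ℂ] Y}
    (hE : ∀ i, IsStarProjection (E i)) (horth : ∀ i j, i ≠ j → E i ∘L E j = 0)
    (htop : ∀ S : Submodule ℂ X, IsClosed (S : Set X) → (∀ i x, E i x ∈ S) → S = ⊤)
    (hs : ∀ i, adjoint (s i) ∘L s i = E i) (hs' : ∀ i j, i ≠ j → adjoint (s i) ∘L s j = 0) :
    ∃ t : X →ₗᵢ[ℂ] Y, ∀ i x, t (E i x) = s i x := by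
  classical
  have hEE (i : ι) (x : X) : E i (E i x) = E i x := congr($((hE i).isIdempotentElem) x)
  have hin (i j : ι) (x y : X) : inner ℂ (s i x) (s j y) = inner ℂ x ((adjoint (s i) ∘L s j) y) := by
    rw [ContinuousLinearMap.comp_apply, ContinuousLinearMap.adjoint_inner_right]
  have hinE (i j : ι) (x y : X) : inner ℂ (E i x) (E j y) = inner ℂ x ((E i ∘L E j) y) := by
    rw [ContinuousLinearMap.comp_apply, ← ContinuousLinearMap.adjoint_inner_right]
    congr 2
    exact (hE i).isSelfAdjoint
  have hnorm (i : ι) (x : X) : ‖s i x‖ = ‖E i x‖ := by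
    rw [@norm_eq_sqrt_re_inner ℂ, @norm_eq_sqrt_re_inner ℂ, hin, hs, hinE]
    congr 3
    exact (hEE i x).symm
  have hsE (i : ι) (x : X) : s i (E i x) = s i x := by
    rw [← sub_eq_zero, ← map_sub, ← norm_eq_zero, hnorm, map_sub, hEE, sub_self, norm_zero]
  let F (i : ι) : Submodule ℂ X := (E i - 1).ker
  have hF (i : ι) (x : X) : x ∈ F i ↔ E i x = x := by
    rw [LinearMap.mem_ker]
    exact sub_eq_zero
  have hFc (i : ι) : IsClosed (F i : Set X) := (E i - 1).isClosed_ker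
  have (i : ι) : CompleteSpace (F i) := (hFc i).completeSpace_coe
  have hFE (i : ι) (x : X) : E i x ∈ F i := (hF i _).2 (hEE i x)
  have hV : IsHilbertSum ℂ (fun i => F i) fun i => (F i).subtypeₗᵢ := by
    refine IsHilbertSum.mkInternal F (fun i j hij x y => ?_) (le_of_eq ?_)
    · change inner ℂ (x : X) (y : X) = 0
      rw [← (hF i x).1 x.2, ← (hF j y).1 y.2, hinE, horth i j hij, zero_apply, inner_zero_right]
    · exact (htop _ (Submodule.isClosed_topologicalClosure _) fun i x =>
        Submodule.le_topologicalClosure _ (Submodule.mem_iSup_of_mem i (hFE i x))).symm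
  let V (i : ι) : F i →ₗᵢ[ℂ] Y :=
    { toLinearMap := (s i ∘L (F i).subtypeL).toLinearMap
      norm_map' := fun x => (hnorm i x).trans (congrArg norm ((hF i x).1 x.2)) }
  have hVo : OrthogonalFamily ℂ (fun i => F i) V := fun i j hij x y => by
    change inner ℂ (s i x) (s j y) = 0
    rw [hin, hs' i j hij, zero_apply, inner_zero_right]
  refine ⟨hVo.linearIsometry.comp hV.linearIsometryEquiv.toLinearIsometry, fun i x => ?_⟩
  have h1 : hV.linearIsometryEquiv (E i x) = lp.single 2 i (⟨E i x, hFE i x⟩ : F i) := by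
    rw [← LinearIsometryEquiv.eq_symm_apply, hV.linearIsometryEquiv_symm_apply_single]
    rfl
  change hVo.linearIsometry (hV.linearIsometryEquiv (E i x)) = _
  rw [h1, hVo.linearIsometry_apply_single]
  exact hsE i x

end Gluing

section Coordinates

variable {ι : Type*} [DecidableEq ι] {E : ι → Type*}
  [∀ i, NormedAddCommGroup (E i)] [∀ i, InnerProductSpace ℂ (E i)] [∀ i, CompleteSpace (E i)]

theorem adjoint_single_apply (i : ι) (x : lp E 2) :
    adjoint (lp.singleContinuousLinearMap ℂ E 2 i) x = x i := by
  refine ext_inner_left ℂ fun a => ?_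
  rw [ContinuousLinearMap.adjoint_inner_right, lp.singleContinuousLinearMap_apply,
    lp.inner_single_left]

theorem adjoint_single_comp_self (i : ι) :
    adjoint (lp.singleContinuousLinearMap ℂ E 2 i) ∘L lp.singleContinuousLinearMap ℂ E 2 i =
      ContinuousLinearMap.id ℂ (E i) := by
  ext a
  simp [adjoint_single_apply]

theorem adjoint_single_comp_of_ne {i j : ι} (hij : i ≠ j) :
    adjoint (lp.singleContinuousLinearMap ℂ E 2 i) ∘L lp.singleContinuousLinearMap ℂ E 2 j = 0 := by
  ext a
  simp [adjoint_single_apply, hij]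

theorem UnitaryRep.single_op {G : Type*} [Group G] [TopologicalSpace G]
    (u : ∀ i, UnitaryRep G (E i)) (i : ι) (g : G) (a : E i) :
    lp.singleContinuousLinearMap ℂ E 2 i ((u i).op g a) =
      (directSum u).op g (lp.singleContinuousLinearMap ℂ E 2 i a) := by
  ext j
  rw [directSum_op_apply]
  by_cases hj : j = i
  · subst hj; simp
  · simp [hj]

end Coordinates

section Total

variable {HA K : Type*} [NormedAddCommGroup HA] [InnerProductSpace ℂ HA]
  [NormedAddCommGroup K] [InnerProductSpace ℂ K]

/-- If subspaces `W i` span a dense subspace of `K`, then the ranges of the projections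
`1 ⊗ P_{W i}` span a dense subspace of `HA ⊗ K`. -/
theorem HilbertTensor.eq_top_of_starProjection {ι : Type*} {W : ι → Submodule ℂ K}
    [∀ i, (W i).HasOrthogonalProjection] (hW : (⨆ i, W i).topologicalClosure = ⊤)
    {S : Submodule ℂ (HilbertTensor HA K)} (hS : IsClosed (S : Set (HilbertTensor HA K)))
    (h : ∀ i x, opTensor (ContinuousLinearMap.id ℂ HA) (W i).starProjection x ∈ S) : S = ⊤ := by
  refine HilbertTensor.eq_top hS fun f x => ?_
  let S' : Submodule ℂ K := S.comap ((tensorVec HA).flip x).toLinearMap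
  have hS' : IsClosed (S' : Set K) := hS.preimage ((tensorVec HA).flip x).continuous
  have hle : (⨆ i, W i).topologicalClosure ≤ S' := by
    refine Submodule.topologicalClosure_minimal _ (iSup_le fun i v hv => ?_) hS'
    have := h i (tensorVec HA v x)
    rw [opTensor_tensorVec, (W i).starProjection_eq_self_iff.2 hv] at this
    exact this
  exact hle (hW ▸ Submodule.mem_top)

end Total

section Compact

variable {A : Type*} [CStarAlgebra A]
variable {HA : Type*} [NormedAddCommGroup HA] [InnerProductSpace ℂ HA] [CompleteSpace HA]
variable {π : A →⋆ₐ[ℂ] (HA →L[ℂ] HA)}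
variable {K L : Type*} [NormedAddCommGroup K] [InnerProductSpace ℂ K] [CompleteSpace K]
  [NormedAddCommGroup L] [InnerProductSpace ℂ L]

/-- An operator that maps `A ⊗ 𝒦` into `A ⊗ 𝒦` after restriction to subspaces `HA ⊗ W i`, where
the `W i` span a dense subspace, maps `A ⊗ 𝒦` into `A ⊗ 𝒦`. -/
theorem comp_mem_compactTensor_of_dense {ι : Type*} {W : ι → Submodule ℂ K}
    [∀ i, (W i).HasOrthogonalProjection] (hW : (⨆ i, W i).topologicalClosure = ⊤)
    {t : HilbertTensor HA K →L[ℂ] HilbertTensor HA L}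
    (ht : ∀ i, t ∘L opTensor (ContinuousLinearMap.id ℂ HA) (W i).starProjection ∈
      compactTensor π K L) {X : HilbertTensor HA K →L[ℂ] HilbertTensor HA K}
    (hX : X ∈ compactTensor π K K) : t ∘L X ∈ compactTensor π K L := by
  let Λ : (HilbertTensor HA K →L[ℂ] HilbertTensor HA K) →L[ℂ]
      (HilbertTensor HA K →L[ℂ] HilbertTensor HA L) := ContinuousLinearMap.compL ℂ _ _ _ t
  let S := (compactTensor π K L).comap Λ.toLinearMap
  refine compactTensor_le π (S := S) ((isClosed_compactTensor π).preimage Λ.continuous)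
    (fun a v w => ?_) hX
  let Ψ : K →L[ℂ] (HilbertTensor HA K →L[ℂ] HilbertTensor HA K) :=
    opTensorL HA HA K K (π a) ∘L (rankOne ℂ).flip w
  have hle : (⨆ i, W i).topologicalClosure ≤ S.comap Ψ.toLinearMap := by
    refine Submodule.topologicalClosure_minimal _ (iSup_le fun i v hv => ?_)
      (((isClosed_compactTensor π).preimage Λ.continuous).preimage Ψ.continuous)
    change t ∘L opTensor (π a) (rankOne ℂ v w) ∈ compactTensor π K L
    have : opTensor (π a) (rankOne ℂ v w) =
        opTensor (ContinuousLinearMap.id ℂ HA) (W i).starProjection ∘L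
          opTensor (π a) (rankOne ℂ v w) := by
      rw [opTensor_comp, ContinuousLinearMap.id_comp, comp_rankOne,
        (W i).starProjection_eq_self_iff.2 hv]
    rw [this, ← ContinuousLinearMap.comp_assoc]
    exact comp_mem_compactTensor (ht i)
      (opTensor_mem_compactTensor (isCompactOperator_rankOne v w) a)
  exact hle (hW ▸ Submodule.mem_top : v ∈ _)

end Compact

/-! ### Freeness yields the isometry -/

section Forward

variable {A : Type u} {G : Type v} [CStarAlgebra A] [Group G] [TopologicalSpace G]
  [IsTopologicalGroup G] [CompactSpace G] [T2Space G] [MeasurableSpace G] [BorelSpace G]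
  {α : CStarDynSystem A G}

theorem opTensor_id_add_sub {HA H Z : Type*} [NormedAddCommGroup HA] [InnerProductSpace ℂ HA]
    [NormedAddCommGroup H] [InnerProductSpace ℂ H] [NormedAddCommGroup Z] [NormedSpace ℂ Z]
    (Q : H →L[ℂ] H) {s : Z →L[ℂ] HilbertTensor HA H}
    (h : opTensor (ContinuousLinearMap.id ℂ HA) (ContinuousLinearMap.id ℂ H - Q) ∘L s = 0) :
    opTensor (ContinuousLinearMap.id ℂ HA) Q ∘L s = s := by
  rwa [opTensor_sub_right, opTensor_id, ContinuousLinearMap.sub_comp, sub_eq_zero,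
    ContinuousLinearMap.id_comp, eq_comm] at h

set_option maxHeartbeats 2000000 in
/-- The representation is a direct sum of multiples of the left regular representations on
the blocks in a decomposition of `L²(G)`. -/
theorem CStarDynSystem.IsFree.exists_isometry (hα : α.IsFree) :
    ∃ (H : Type (max u v w)) (_ : NormedAddCommGroup H) (_ : InnerProductSpace ℂ H)
      (_ : CompleteSpace H) (μ : UnitaryRep G H),
      μ.HasFiniteMultiplicities ∧
      ∀ (HA : Type (max u v w)) [NormedAddCommGroup HA] [InnerProductSpace ℂ HA]
        [CompleteSpace HA] (π : A →⋆ₐ[ℂ] (HA →L[ℂ] HA)) (u : UnitaryRep G HA),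
        IsFaithfulCovariantRep α π u →
        ∃ s : HilbertTensor HA (L2 G) →ₗᵢ[ℂ] HilbertTensor HA H,
          (∀ X ∈ compactTensor π (L2 G) (L2 G),
            s.toContinuousLinearMap ∘L X ∈ compactTensor π (L2 G) H) ∧
          (∀ g : G, opTensor (u.op g) (ContinuousLinearMap.id ℂ H) ∘L s.toContinuousLinearMap =
            s.toContinuousLinearMap ∘L opTensor (u.op g) (rightReg g)) ∧
          (∀ g : G, opTensor (ContinuousLinearMap.id ℂ HA) (μ.op g) ∘L s.toContinuousLinearMap =
            s.toContinuousLinearMap ∘L opTensor (ContinuousLinearMap.id ℂ HA) (leftReg g)) := by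
  classical
  obtain ⟨𝒲, horth, htop⟩ := exists_orthogonal_blocks G
  choose m F hm hF using fun W : 𝒲 => hα.exists_mollifier_finset W.1
  -- The index set of the summands: `F W` copies of every block `W`.
  let J : Type (max u v w) := ULift.{w} (Σ W : 𝒲, F W)
  let B (j : J) : Block G := j.down.1.1
  have horth' (V W : 𝒲) (h : V ≠ W) : V.1.toSubmodule ⟂ W.1.toSubmodule :=
    horth V.2 W.2 fun h' => h (Subtype.ext h')
  refine ⟨lp (fun j => (B j).toSubmodule) 2, inferInstance, inferInstance, inferInstance,
    UnitaryRep.directSum fun j => (B j).rep, ?_, ?_⟩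
  · refine hasFiniteMultiplicities_directSum_blocks B (fun j k hjk => horth j.down.1.2 k.down.1.2 hjk)
      fun b => ?_
    by_cases hb : b ∈ 𝒲
    · refine (Set.finite_range fun k : F ⟨b, hb⟩ => (⟨⟨⟨b, hb⟩, k⟩⟩ : J)).subset ?_
      rintro ⟨⟨⟨b', hb'⟩, k⟩⟩ (rfl : b' = b)
      exact ⟨k, rfl⟩
    · refine Set.finite_empty.subset ?_
      rintro j (rfl : B j = b)
      exact hb j.down.1.2
  intro HA _ _ _ π u h
  let ι (W : 𝒲) (k : F W) : W.1.toSubmodule →L[ℂ] lp (fun j => (B j).toSubmodule) 2 :=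
    lp.singleContinuousLinearMap ℂ (fun j => (B j).toSubmodule) 2 (⟨⟨W, k⟩⟩ : J)
  have hι (W : 𝒲) (k : F W) : adjoint (ι W k) ∘L ι W k = ContinuousLinearMap.id ℂ _ :=
    adjoint_single_comp_self (⟨⟨W, k⟩⟩ : J)
  have hι' (W : 𝒲) (k l : F W) (hkl : k ≠ l) : adjoint (ι W k) ∘L ι W l = 0 :=
    adjoint_single_comp_of_ne (i := (⟨⟨W, k⟩⟩ : J)) (j := ⟨⟨W, l⟩⟩) (by simpa using hkl)
  have hι'' (V W : 𝒲) (hVW : V ≠ W) (k l) : adjoint (ι V k) ∘L ι W l = 0 :=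
    adjoint_single_comp_of_ne (i := (⟨⟨V, k⟩⟩ : J)) (j := ⟨⟨W, l⟩⟩) (by
      rintro ⟨⟩; exact hVW rfl)
  choose s hs1 hs2 hs3 hs4 hs5 using fun W : 𝒲 => exists_block_isometry (hm W) (hF W) (hι W)
    (hι' W) (fun k g x => UnitaryRep.single_op (fun j => (B j).rep) (⟨⟨W, k⟩⟩ : J) g x) h
  set I := ContinuousLinearMap.id ℂ HA
  -- The projection onto the copies of the block `W`; it is used for the orthogonality of the ranges.
  let Q (W : 𝒲) := ∑ k, ι W k ∘L adjoint (ι W k)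
  have hQ (W : 𝒲) : adjoint (Q W) = Q W := by
    simp only [Q, map_sum, ContinuousLinearMap.adjoint_comp, ContinuousLinearMap.adjoint_adjoint]
  have hQs (W : 𝒲) : opTensor I (Q W) ∘L s W = s W := by
    refine opTensor_id_add_sub _ (hs5 W _ fun k => ?_)
    have : Q W ∘L ι W k = ι W k := by
      simp only [Q, ContinuousLinearMap.finsetSum_comp, ContinuousLinearMap.comp_assoc]
      rw [Finset.sum_eq_single k (fun l _ hl => by rw [hι' W l k hl, ContinuousLinearMap.comp_zero])
        (by simp), hι, ContinuousLinearMap.comp_id]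
    rw [ContinuousLinearMap.sub_comp, this, ContinuousLinearMap.id_comp, sub_self]
  have hQs' (V W : 𝒲) (hVW : V ≠ W) : opTensor I (Q W) ∘L s V = 0 := by
    refine hs5 V _ fun k => ?_
    simp only [Q, ContinuousLinearMap.finsetSum_comp, ContinuousLinearMap.comp_assoc]
    exact Finset.sum_eq_zero fun l _ => by
      rw [hι'' W V hVW.symm, ContinuousLinearMap.comp_zero]
  let E (W : 𝒲) : HilbertTensor HA (L2 G) →L[ℂ] HilbertTensor HA (L2 G) :=
    opTensor I W.1.toSubmodule.starProjection
  have hEcomm (W : 𝒲) {S : HA →L[ℂ] HA} {R : L2 G →L[ℂ] L2 G}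
      (hR : ∀ x, W.1.toSubmodule.starProjection (R x) = R (W.1.toSubmodule.starProjection x)) :
      opTensor S R ∘L E W = E W ∘L opTensor S R := by
    simp only [E, opTensor_comp]
    rw [show W.1.toSubmodule.starProjection ∘L R = R ∘L W.1.toSubmodule.starProjection from
      ContinuousLinearMap.ext hR]
    rfl
  have htop' : (⨆ W : 𝒲, W.1.toSubmodule).topologicalClosure = ⊤ := htop
  obtain ⟨t, ht⟩ := exists_isometry_of_orthogonal (E := E) (s := s)
    (fun W => by
      refine ⟨?_, ?_⟩
      · change opTensor I _ ∘L opTensor I _ = opTensor I _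
        rw [opTensor_comp]
        exact congrArg (opTensor I) W.1.toSubmodule.isIdempotentElem_starProjection
      · change adjoint (opTensor I _) = _
        rw [adjoint_opTensor, ContinuousLinearMap.adjoint_id]
        exact congrArg (opTensor I) (isSelfAdjoint_starProjection W.1.toSubmodule))
    (fun V W hVW => by
      have : V.1.toSubmodule.starProjection ∘L W.1.toSubmodule.starProjection = 0 := by
        ext1 x
        exact (Submodule.starProjection_apply_eq_zero_iff _).2
          ((horth' W V hVW.symm) (Submodule.starProjection_apply_mem _ x))
      simp only [E, opTensor_comp, this, opTensor_zero_right])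
    (fun S hS h => HilbertTensor.eq_top_of_starProjection htop' hS h) hs2
    (fun V W hVW => by
      rw [← hQs W, ← ContinuousLinearMap.comp_assoc]
      have : adjoint (opTensor I (Q W) ∘L s V) = 0 := by rw [hQs' V W hVW, map_zero]
      rw [ContinuousLinearMap.adjoint_comp, adjoint_opTensor, hQ,
        ContinuousLinearMap.adjoint_id] at this
      rw [this, ContinuousLinearMap.zero_comp])
  set T := t.toContinuousLinearMap
  have htE (W : 𝒲) : T ∘L E W = s W := ContinuousLinearMap.ext (ht W)
  have hext {U : HilbertTensor HA (lp (fun j => (B j).toSubmodule) 2) →L[ℂ]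
        HilbertTensor HA (lp (fun j => (B j).toSubmodule) 2)}
      {S : HA →L[ℂ] HA} {R : L2 G →L[ℂ] L2 G}
      (hR : ∀ (W : 𝒲) x,
        W.1.toSubmodule.starProjection (R x) = R (W.1.toSubmodule.starProjection x))
      (hU : ∀ W, U ∘L s W = s W ∘L opTensor S R) : U ∘L T = T ∘L opTensor S R := by
    have h1 := HilbertTensor.eq_top_of_starProjection htop'
      (S := (U ∘L T - T ∘L opTensor S R).ker) (ContinuousLinearMap.isClosed_ker _) fun W x => by
        have : (U ∘L T) ∘L E W = (T ∘L opTensor S R) ∘L E W := by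
          rw [ContinuousLinearMap.comp_assoc, htE, hU, ContinuousLinearMap.comp_assoc,
            hEcomm W (hR W), ← ContinuousLinearMap.comp_assoc, htE]
        rw [LinearMap.mem_ker]
        exact sub_eq_zero.2 congr($this x)
    ext x
    have hx : x ∈ (U ∘L T - T ∘L opTensor S R).ker := h1 ▸ Submodule.mem_top
    exact sub_eq_zero.1 hx
  refine ⟨t, fun X hX => ?_, fun g => ?_, fun g => ?_⟩
  · refine comp_mem_compactTensor_of_dense htop' (fun W => ?_) hX
    have : T ∘L opTensor I W.1.toSubmodule.starProjection = s W := htE W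
    rw [this]
    exact hs1 W
  · exact hext (fun W x => (rightRep G).starProjection_op W.1.toSubmodule W.1.rightReg_mem g x)
      fun W => hs3 W g
  · exact hext (fun W x => (leftRep G).starProjection_op W.1.toSubmodule W.1.leftReg_mem g x)
      fun W => hs4 W g

end Forward

/-! ### Existence of faithful covariant representations -/

section InvariantFunctional

open scoped ComplexOrder

variable {A G : Type*} [CStarAlgebra A] [PartialOrder A] [StarOrderedRing A]
  [Group G] [TopologicalSpace G] [IsTopologicalGroup G] [CompactSpace G]
  [MeasurableSpace G] [BorelSpace G]

/-- Invariant positive functionals separate points: a separating real functional exists by the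
Hahn-Banach theorem, it is averaged over `G`, and its extension to a complex functional is
positive once it is made invariant under the involution. -/
theorem exists_invariant_positive (α : CStarDynSystem A G) {a : A} (ha : a ≠ 0) :
    ∃ φ : A →ₚ[ℂ] ℂ, (∀ g x, φ (α.act g x) = φ x) ∧ φ (star a * a) ≠ 0 := by
  have haa : star a * a ≠ 0 := by rwa [Ne, CStarRing.star_mul_self_eq_zero_iff]
  have hneg : -(star a * a) ∉ ProperCone.positive ℝ A := fun h =>
    haa (le_antisymm (neg_nonneg.1 h) (star_mul_self_nonneg a))
  obtain ⟨f, hf, hfa⟩ := (ProperCone.positive ℝ A).hyperplane_separation_point hneg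
  rw [map_neg, neg_lt_zero] at hfa
  have hc (x : A) : Continuous fun g => f (α.act g x) := f.continuous.comp (α.continuous_orbit x)
  let F : A →ₗ[ℝ] ℝ :=
    { toFun := fun x => ∫ g, f (α.act g x) ∂haarProb G
      map_add' := fun x y => by
        simp only [map_add]
        exact integral_add (integrable_haarProb (hc x)) (integrable_haarProb (hc y))
      map_smul' := fun c x => by
        have (g : G) : f (α.act g (c • x)) = c • f (α.act g x) := by
          rw [← map_smul, ← Complex.coe_smul, ← Complex.coe_smul, map_smul]
        simp only [this, RingHom.id_apply]
        exact integral_smul c _ }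
  have hF (x : A) : F x = ∫ g, f (α.act g x) ∂haarProb G := rfl
  have hFinv (h : G) (x : A) : F (α.act h x) = F x := by
    rw [hF, hF, ← integral_mul_right_eq_self (fun g => f (α.act g x)) h]
    congr 1
    funext g
    rw [map_mul]; rfl
  have hpos (g : G) (x : A) (hx : 0 ≤ x) : 0 ≤ α.act g x := map_nonneg (α.act g) hx
  have hF0 (x : A) (hx : 0 ≤ x) : 0 ≤ F x :=
    integral_nonneg fun g => hf _ (hpos g x hx)
  have hFa : 0 < F (star a * a) := by
    refine (hc _).integral_pos_of_hasCompactSupport_nonneg_nonzero (.of_compactSpace _)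
      (fun g => hf _ (hpos g _ (star_mul_self_nonneg a))) (x := 1) ?_
    rw [map_one]
    exact hfa.ne'
  let S : A →ₗ[ℝ] A := (starLinearEquiv ℝ (A := A)).toLinearMap
  let F' : Module.Dual ℝ A := F + F ∘ₗ S
  have hF' (x : A) : F' x = F x + F (star x) := rfl
  have hφ (x : A) (hx : 0 ≤ x) : F'.extendRCLike (𝕜 := ℂ) x = ((2 * F x : ℝ) : ℂ) := by
    have hs : star x = x := (IsSelfAdjoint.of_nonneg hx).star_eq
    rw [Module.Dual.extendRCLike_apply, hF', hF', star_smul, hs]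
    have : star (RCLike.I : ℂ) = -RCLike.I := by simp
    rw [this, neg_smul, map_neg, add_neg_cancel, two_mul]
    simp
  refine ⟨PositiveLinearMap.mk₀ (F'.extendRCLike (𝕜 := ℂ)) fun x hx => ?_, fun g x => ?_, ?_⟩
  · rw [hφ x hx]
    exact_mod_cast mul_nonneg zero_le_two (hF0 x hx)
  · change F'.extendRCLike (𝕜 := ℂ) _ = F'.extendRCLike (𝕜 := ℂ) _
    rw [Module.Dual.extendRCLike_apply, Module.Dual.extendRCLike_apply, ← map_smul]
    simp only [hF', ← map_star, hFinv]
  · change F'.extendRCLike (𝕜 := ℂ) _ ≠ 0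
    rw [hφ _ (star_mul_self_nonneg a)]
    exact_mod_cast (mul_pos zero_lt_two hFa).ne'

/-- The representation given by the GNS construction for an invariant positive functional is
covariant. -/
theorem exists_covariant_gns {A : Type u} {G : Type v} [CStarAlgebra A] [PartialOrder A]
    [StarOrderedRing A] [Group G] [TopologicalSpace G] (α : CStarDynSystem A G) {φ : A →ₚ[ℂ] ℂ}
    (hφ : ∀ g x, φ (α.act g x) = φ x) :
    ∃ (H : Type u) (_ : NormedAddCommGroup H) (_ : InnerProductSpace ℂ H) (_ : CompleteSpace H)
      (π : A →⋆ₐ[ℂ] (H →L[ℂ] H)) (u : UnitaryRep G H),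
      (∀ g a, u.op g ∘L π a = π (α.act g a) ∘L u.op g) ∧
        ∀ a, φ (star a * a) ≠ 0 → π a ≠ 0 := by
  have hstar (g : G) (y : A) : φ (star (α.act g y) * α.act g y) = φ (star y * y) := by
    rw [← map_star (α.act g), ← map_mul (α.act g), hφ]
  let U (g : G) : φ.PreGNS →L[ℂ] φ.PreGNS :=
    (φ.toPreGNS.toLinearMap ∘ₗ ((α.act g : A ≃⋆ₐ[ℂ] A) : A →ₗ[ℂ] A) ∘ₗ
      φ.ofPreGNS.toLinearMap).mkContinuous 1 fun x => by
        rw [one_mul, φ.preGNS_norm_def, φ.preGNS_norm_def]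
        exact (congrArg (fun z : ℂ => √z.re) (hstar g (φ.ofPreGNS x))).le
  have hU (g : G) (x : φ.PreGNS) : U g x = φ.toPreGNS (α.act g (φ.ofPreGNS x)) := rfl
  let T (g : G) : φ.GNS →L[ℂ] φ.GNS := (U g).completion
  have hT (g : G) (x : φ.PreGNS) : T g (x : φ.GNS) = (U g x : φ.PreGNS) :=
    ContinuousLinearMap.completion_apply_coe _ _
  have hTnorm (g : G) (x : φ.GNS) : ‖T g x‖ = ‖x‖ := by
    induction x using UniformSpace.Completion.induction_on with
    | hp => exact isClosed_eq (T g).continuous.norm continuous_norm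
    | ih x =>
      rw [hT, UniformSpace.Completion.norm_coe, UniformSpace.Completion.norm_coe,
        φ.preGNS_norm_def, φ.preGNS_norm_def, hU, φ.ofPreGNS_toPreGNS, hstar]
  have hπ (a : A) (x : φ.PreGNS) : φ.gnsStarAlgHom a (x : φ.GNS) =
      (φ.toPreGNS (a * φ.ofPreGNS x) : φ.PreGNS) := φ.gnsNonUnitalStarAlgHom_apply_coe
  have hext {S S' : φ.GNS →L[ℂ] φ.GNS} (h : ∀ x : φ.PreGNS, S x = S' x) : S = S' := by
    ext x
    induction x using UniformSpace.Completion.induction_on with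
    | hp => exact isClosed_eq S.continuous S'.continuous
    | ih x => exact h x
  let ξ : φ.GNS := (φ.toPreGNS 1 : φ.PreGNS)
  have hξ (x : A) : ((φ.toPreGNS x : φ.PreGNS) : φ.GNS) = φ.gnsStarAlgHom x ξ := by
    rw [hπ, φ.ofPreGNS_toPreGNS, mul_one]
  let u : UnitaryRep G φ.GNS := UnitaryRep.ofIsometric T
    (hext fun x => by rw [hT, hU, map_one]; rfl)
    (fun g k => hext fun x => by
      rw [mul_apply_eq_comp, hT, hT, hT, hU, hU, hU, map_mul]; rfl)
    hTnorm
    (UnitaryRep.continuous_of_total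
      (fun g => ContinuousLinearMap.opNorm_le_bound _ zero_le_one fun x => by
        rw [hTnorm, one_mul])
      (s := Set.range ((↑) : φ.PreGNS → φ.GNS))
      (by
        refine Submodule.eq_top_iff'.2 fun x => ?_
        exact closure_mono Submodule.subset_span (UniformSpace.Completion.denseRange_coe x))
      (by
        rintro _ ⟨x, rfl⟩
        have : (fun g => T g (x : φ.GNS)) =
            fun g => φ.gnsStarAlgHom (α.act g (φ.ofPreGNS x)) ξ := by
          funext g
          rw [hT, hU, hξ]
        rw [this]
        have hc : Continuous φ.gnsStarAlgHom :=
          AddMonoidHomClass.continuous_of_bound φ.gnsStarAlgHom 1 fun x => by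
            rw [one_mul]; exact NonUnitalStarAlgHom.norm_apply_le _ x
        exact (hc.comp (α.continuous_orbit _)).clm_apply continuous_const))
  refine ⟨φ.GNS, inferInstance, inferInstance, inferInstance, φ.gnsStarAlgHom, u, fun g a => ?_,
    fun a ha h => ha ?_⟩
  · refine hext fun x => ?_
    change T g (φ.gnsStarAlgHom a x) = φ.gnsStarAlgHom _ (T g x)
    rw [hπ, hT, hT, hπ, hU, hU]
    simp
  · have h1 : (φ.toPreGNS a : φ.GNS) = 0 := by rw [hξ, h]; rfl
    have h2 : ‖φ.toPreGNS a‖ = 0 := by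
      rw [← UniformSpace.Completion.norm_coe, h1, norm_zero]
    have h3 := φ.preGNS_norm_sq (φ.toPreGNS a)
    rw [h2] at h3
    simpa using h3.symm

end InvariantFunctional

section DirectSum

open scoped ComplexOrder

/-- The direct sum of representations of a C*-algebra. -/
def directSumRep {A ι : Type*} [CStarAlgebra A] {E : ι → Type*} [∀ i, NormedAddCommGroup (E i)]
    [∀ i, InnerProductSpace ℂ (E i)] [∀ i, CompleteSpace (E i)]
    (π : ∀ i, A →⋆ₐ[ℂ] (E i →L[ℂ] E i)) : A →⋆ₐ[ℂ] (lp E 2 →L[ℂ] lp E 2) where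
  toFun a := lp.mapCLM 2 (fun i => π i a) (norm_nonneg a)
    fun i => NonUnitalStarAlgHom.norm_apply_le (π i) a
  map_one' := by ext x i; simp
  map_mul' a b := by ext x i; simp
  map_zero' := by ext x i; simp
  map_add' a b := by ext x i; simp
  commutes' r := by ext x i; simp [Algebra.algebraMap_eq_smul_one]
  map_star' a := by
    rw [ContinuousLinearMap.star_eq_adjoint, ContinuousLinearMap.eq_adjoint_iff]
    intro x y
    rw [lp.inner_eq_tsum, lp.inner_eq_tsum]
    congr 1
    funext i
    simp [map_star, ContinuousLinearMap.star_eq_adjoint, ContinuousLinearMap.adjoint_inner_left]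

theorem directSumRep_apply {A ι : Type*} [CStarAlgebra A] {E : ι → Type*}
    [∀ i, NormedAddCommGroup (E i)] [∀ i, InnerProductSpace ℂ (E i)] [∀ i, CompleteSpace (E i)]
    (π : ∀ i, A →⋆ₐ[ℂ] (E i →L[ℂ] E i)) (a : A) (x : lp E 2) (i : ι) :
    directSumRep π a x i = π i a (x i) := rfl

/-- Every C*-dynamical system with a compact group has a faithful covariant representation. -/
theorem exists_isFaithfulCovariantRep {A : Type u} {G : Type v} [CStarAlgebra A] [Group G]
    [TopologicalSpace G] [IsTopologicalGroup G] [CompactSpace G] [MeasurableSpace G] [BorelSpace G]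
    (α : CStarDynSystem A G) :
    ∃ (H : Type (max u v w)) (_ : NormedAddCommGroup H) (_ : InnerProductSpace ℂ H)
      (_ : CompleteSpace H) (π : A →⋆ₐ[ℂ] (H →L[ℂ] H)) (u : UnitaryRep G H),
      IsFaithfulCovariantRep α π u := by
  classical
  let _ := CStarAlgebra.spectralOrder A
  have := CStarAlgebra.spectralOrderedRing A
  let Γ : Type (max u v w) := ULift.{max v w} {φ : A →ₚ[ℂ] ℂ // ∀ g x, φ (α.act g x) = φ x}
  choose E hE1 hE2 hE3 π u hcov hne using fun φ : Γ => exists_covariant_gns α φ.down.2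
  refine ⟨lp E 2, inferInstance, inferInstance, inferInstance, directSumRep π,
    UnitaryRep.directSum u, ?_, fun g a => ?_⟩
  · refine (injective_iff_map_eq_zero _).2 fun a ha => ?_
    by_contra ha0
    obtain ⟨φ, hφ, hφa⟩ := exists_invariant_positive α ha0
    refine hne ⟨⟨φ, hφ⟩⟩ a hφa ?_
    ext x
    have := congr($ha (lp.single 2 (⟨⟨φ, hφ⟩⟩ : Γ) x) ⟨⟨φ, hφ⟩⟩)
    rw [directSumRep_apply] at this
    simpa using this
  · rw [ContinuousLinearMap.star_eq_adjoint, UnitaryRep.adjoint_op]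
    ext x i
    simp only [ContinuousLinearMap.comp_apply, UnitaryRep.directSum_op_apply, directSumRep_apply]
    have := congr($(hcov i g a) ((u i).op g⁻¹ (x i)))
    simpa using this

end DirectSum

/-! ### The isometry yields freeness -/

namespace CStarDynSystem

section EllwoodRange

variable {A G : Type*} [CStarAlgebra A] [Group G] [TopologicalSpace G]
  (α : CStarDynSystem A G)

/-- The closure of the range of the Ellwood map. -/
def ellwoodClosure : Submodule ℂ C(G, A) := (LinearMap.range α.ellwoodMap).topologicalClosure

theorem ellwoodFun_mem_range (x y : A) : α.ellwoodFun x y ∈ LinearMap.range α.ellwoodMap :=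
  ⟨x ⊗ₜ y, rfl⟩

theorem const_mul_mem_ellwoodClosure [CompactSpace G] (x : A) {f : C(G, A)} (hf : f ∈ α.ellwoodClosure) :
    ContinuousMap.const G x * f ∈ α.ellwoodClosure := by
  have hc : Continuous fun f : C(G, A) => ContinuousMap.const G x * f :=
    continuous_const.mul continuous_id
  have hle : α.ellwoodClosure ≤
      α.ellwoodClosure.comap (LinearMap.mulLeft ℂ (ContinuousMap.const G x)) := by
    refine Submodule.topologicalClosure_minimal _ ?_
      ((Submodule.isClosed_topologicalClosure _).preimage hc)
    rintro _ ⟨z, rfl⟩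
    refine Submodule.le_topologicalClosure _ ?_
    induction z using TensorProduct.induction_on with
    | zero => simp
    | tmul a b => exact ⟨(x * a) ⊗ₜ b, by ext g; exact mul_assoc _ _ _⟩
    | add z z' hz hz' => rw [map_add, map_add]; exact add_mem hz hz'
  exact hle hf

end EllwoodRange

end CStarDynSystem

section Vectors

variable {A G : Type*} [CStarAlgebra A] [Group G] [TopologicalSpace G]
variable {α : CStarDynSystem A G}
variable {HA : Type*} [NormedAddCommGroup HA] [InnerProductSpace ℂ HA] [CompleteSpace HA]
variable {π : A →⋆ₐ[ℂ] (HA →L[ℂ] HA)} {u : UnitaryRep G HA}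
variable {H K : Type*} [NormedAddCommGroup H] [InnerProductSpace ℂ H]
  [NormedAddCommGroup K] [InnerProductSpace ℂ K]

variable (π H) in
/-- The span of the operators `v ↦ π(a) v ⊗ h` from `HA` to `HA ⊗ H`. -/
def vecSpan : Submodule ℂ (HA →L[ℂ] HilbertTensor HA H) :=
  Submodule.span ℂ {Y | ∃ (h : H) (a : A), Y = tensorVec HA h ∘L π a}

/-- The elements of `A ⊗ 𝒦(K, H)`, restricted to a copy `HA ⊗ f` of `HA`. -/
theorem comp_tensorVec_mem {Z : HilbertTensor HA K →L[ℂ] HilbertTensor HA H}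
    (hZ : Z ∈ compactTensor π K H) (f : K) :
    Z ∘L tensorVec HA f ∈ (vecSpan π H).topologicalClosure := by
  let Λ : (HilbertTensor HA K →L[ℂ] HilbertTensor HA H) →L[ℂ] (HA →L[ℂ] HilbertTensor HA H) :=
    (ContinuousLinearMap.compL ℂ _ _ _).flip (tensorVec HA f)
  have hle : compactTensor π K H ≤ (vecSpan π H).topologicalClosure.comap Λ.toLinearMap := by
    refine Submodule.topologicalClosure_minimal _ (Submodule.span_le.2 ?_)
      ((Submodule.isClosed_topologicalClosure _).preimage Λ.continuous)
    rintro _ ⟨a, T, -, rfl⟩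
    refine Submodule.le_topologicalClosure _ (Submodule.subset_span ⟨T f, a, ?_⟩)
    exact opTensor_comp_tensorVec _ _ _
  exact hle hZ

/-- The coefficient `Y* (u_g ⊗ 1) Y' u_g*`, for `Y`, `Y'` from `HA` to `HA ⊗ H`. -/
def coeffOp (u : UnitaryRep G HA) (Y Y' : HA →L[ℂ] HilbertTensor HA H) (g : G) : HA →L[ℂ] HA :=
  adjoint Y ∘L opTensor (u.op g) (ContinuousLinearMap.id ℂ H) ∘L Y' ∘L u.op g⁻¹

theorem norm_coeffOp_le (Y Y' : HA →L[ℂ] HilbertTensor HA H) (g : G) :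
    ‖coeffOp u Y Y' g‖ ≤ ‖Y‖ * ‖Y'‖ := by
  have h1 : ‖opTensor (u.op g) (ContinuousLinearMap.id ℂ H)‖ ≤ 1 :=
    (norm_opTensor_le _ _).trans
      (mul_le_one₀ (u.norm_op_le g) (norm_nonneg _) ContinuousLinearMap.norm_id_le)
  refine ContinuousLinearMap.opNorm_le_bound _ (by positivity) fun x => ?_
  calc ‖coeffOp u Y Y' g x‖
      ≤ ‖adjoint Y‖ * ‖opTensor (u.op g) (ContinuousLinearMap.id ℂ H) (Y' (u.op g⁻¹ x))‖ :=
        (adjoint Y).le_opNorm _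
    _ ≤ ‖Y‖ * (1 * (‖Y'‖ * ‖x‖)) := by
        rw [LinearIsometryEquiv.norm_map]
        refine mul_le_mul_of_nonneg_left ?_ (norm_nonneg _)
        refine ContinuousLinearMap.le_of_opNorm_le_of_le _ h1 ?_
        exact (Y'.le_opNorm _).trans (by rw [u.norm_op_apply])
    _ = ‖Y‖ * ‖Y'‖ * ‖x‖ := by ring

theorem coeffOp_sub (Y₁ Y₂ Y₁' Y₂' : HA →L[ℂ] HilbertTensor HA H) (g : G) :
    coeffOp u Y₁ Y₁' g - coeffOp u Y₂ Y₂' g =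
      coeffOp u (Y₁ - Y₂) Y₁' g + coeffOp u Y₂ (Y₁' - Y₂') g := by
  ext x
  simp [coeffOp]

theorem coeffOp_tensorVec (h : IsFaithfulCovariantRep α π u) (k k' : H) (a b : A) (g : G) :
    coeffOp u (tensorVec HA k ∘L π a) (tensorVec HA k' ∘L π b) g =
      π ((inner ℂ k k' : ℂ) • (star a * α.act g b)) := by
  rw [map_smul, map_mul, map_star, ← h.2 g b]
  ext x
  simp [coeffOp, ContinuousLinearMap.adjoint_comp, adjoint_tensorVec_tensorVec,
    ContinuousLinearMap.star_eq_adjoint, u.adjoint_op]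

/-- The coefficients of `Y`, `Y'` in the span are of the form `g ↦ π(z(g))` with `z` in the range
of the Ellwood map; for `Y = π(a) ⊗ k` and `Y' = π(b) ⊗ k'` the function `z` is
`⟪k, k'⟫ Φ(a* ⊗ b)`. -/
theorem exists_coeffOp_eq (h : IsFaithfulCovariantRep α π u)
    {Y Y' : HA →L[ℂ] HilbertTensor HA H} (hY : Y ∈ vecSpan π H) (hY' : Y' ∈ vecSpan π H) :
    ∃ z ∈ LinearMap.range α.ellwoodMap, ∀ g, coeffOp u Y Y' g = π (z g) := by
  induction hY, hY' using Submodule.span_induction₂ with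
  | mem_mem Y Y' hY hY' =>
    obtain ⟨k, a, rfl⟩ := hY
    obtain ⟨k', b, rfl⟩ := hY'
    exact ⟨(inner ℂ k k' : ℂ) • α.ellwoodFun (star a) b,
      Submodule.smul_mem _ _ (α.ellwoodFun_mem_range _ _), coeffOp_tensorVec h k k' a b⟩
  | zero_left Y' _ => exact ⟨0, zero_mem _, fun g => by ext x; simp [coeffOp]⟩
  | zero_right Y _ => exact ⟨0, zero_mem _, fun g => by ext x; simp [coeffOp]⟩
  | add_left Y₁ Y₂ Y' _ _ _ h1 h2 =>
    obtain ⟨z1, hz1, e1⟩ := h1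
    obtain ⟨z2, hz2, e2⟩ := h2
    refine ⟨z1 + z2, add_mem hz1 hz2, fun g => ?_⟩
    rw [ContinuousMap.add_apply, map_add, ← e1, ← e2]
    ext x; simp [coeffOp]
  | add_right Y Y₁ Y₂ _ _ _ h1 h2 =>
    obtain ⟨z1, hz1, e1⟩ := h1
    obtain ⟨z2, hz2, e2⟩ := h2
    refine ⟨z1 + z2, add_mem hz1 hz2, fun g => ?_⟩
    rw [ContinuousMap.add_apply, map_add, ← e1, ← e2]
    ext x; simp [coeffOp]
  | smul_left c Y Y' _ _ h1 =>
    obtain ⟨z1, hz1, e1⟩ := h1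
    refine ⟨starRingEnd ℂ c • z1, Submodule.smul_mem _ _ hz1, fun g => ?_⟩
    rw [ContinuousMap.smul_apply, map_smul, ← e1]
    have hc : adjoint (c • Y) = starRingEnd ℂ c • adjoint Y := map_smulₛₗ _ _ _
    ext x; simp [coeffOp, hc]
  | smul_right c Y Y' _ _ h1 =>
    obtain ⟨z1, hz1, e1⟩ := h1
    refine ⟨c • z1, Submodule.smul_mem _ _ hz1, fun g => ?_⟩
    rw [ContinuousMap.smul_apply, map_smul, ← e1]
    ext x; simp [coeffOp]

/-- For `Y`, `Y'` in the closure of the span, the coefficients are uniform limits of functions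
`g ↦ π (z g)` with `z` in the range of the Ellwood map. -/
theorem exists_norm_coeffOp_sub_le (h : IsFaithfulCovariantRep α π u)
    {Y Y' : HA →L[ℂ] HilbertTensor HA H} (hY : Y ∈ (vecSpan π H).topologicalClosure)
    (hY' : Y' ∈ (vecSpan π H).topologicalClosure) {ε : ℝ} (hε : 0 < ε) :
    ∃ z ∈ LinearMap.range α.ellwoodMap, ∀ g, ‖coeffOp u Y Y' g - π (z g)‖ ≤ ε := by
  obtain ⟨Z, hZ, hYZ⟩ := Metric.mem_closure_iff.1 hY (ε / 2 / (‖Y'‖ + 1)) (by positivity)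
  obtain ⟨Z', hZ', hYZ'⟩ := Metric.mem_closure_iff.1 hY' (ε / 2 / (‖Z‖ + 1)) (by positivity)
  obtain ⟨z, hz, e⟩ := exists_coeffOp_eq h hZ hZ'
  refine ⟨z, hz, fun g => ?_⟩
  rw [dist_eq_norm, lt_div_iff₀ (by positivity)] at hYZ hYZ'
  rw [← e, coeffOp_sub]
  refine (norm_add_le _ _).trans
    ((add_le_add (norm_coeffOp_le _ _ g) (norm_coeffOp_le _ _ g)).trans ?_)
  nlinarith [norm_nonneg (Y - Z), norm_nonneg (Y' - Z')]

end Vectors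

section Backward

variable {A G : Type*} [CStarAlgebra A] [Group G] [TopologicalSpace G] [IsTopologicalGroup G]
  [CompactSpace G] [MeasurableSpace G] [BorelSpace G] {α : CStarDynSystem A G}
variable {HA : Type*} [NormedAddCommGroup HA] [InnerProductSpace ℂ HA] [CompleteSpace HA]
variable {π : A →⋆ₐ[ℂ] (HA →L[ℂ] HA)} {u : UnitaryRep G HA}
variable {H : Type*} [NormedAddCommGroup H] [InnerProductSpace ℂ H]

/-- With a unit vector `f₀`, the operator `s (· ⊗ f)` is the restriction to `HA ⊗ f₀` of the
operator `s (1 ⊗ |f⟩⟨f₀|)`, which is in `A ⊗ 𝒦(L²(G), H)`. -/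
theorem isometry_comp_tensorVec_mem {s : HilbertTensor HA (L2 G) →ₗᵢ[ℂ] HilbertTensor HA H}
    (hs : ∀ X ∈ compactTensor π (L2 G) (L2 G),
      s.toContinuousLinearMap ∘L X ∈ compactTensor π (L2 G) H) (f : L2 G) :
    s.toContinuousLinearMap ∘L tensorVec HA f ∈ (vecSpan π H).topologicalClosure := by
  set f₀ : L2 G := toL2 G 1
  have h0 : inner ℂ f₀ f₀ = (1 : ℂ) := by rw [inner_toL2]; simp
  have h1 : tensorVec HA f = opTensor (π 1) (rankOne ℂ f f₀) ∘L tensorVec HA f₀ := by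
    rw [opTensor_comp_tensorVec, rankOne_apply, h0, one_smul, map_one]
    rfl
  rw [h1, ← ContinuousLinearMap.comp_assoc]
  exact comp_tensorVec_mem (hs _ (opTensor_mem_compactTensor (isCompactOperator_rankOne _ _) _)) f₀

/-- The coefficients of the operators `s (· ⊗ f)` are the matrix coefficients of the right regular
representation. -/
theorem coeffOp_isometry {s : HilbertTensor HA (L2 G) →ₗᵢ[ℂ] HilbertTensor HA H}
    (hs : ∀ g : G, opTensor (u.op g) (ContinuousLinearMap.id ℂ H) ∘L s.toContinuousLinearMap =
      s.toContinuousLinearMap ∘L opTensor (u.op g) (rightReg g)) (f f' : L2 G) (g : G) :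
    coeffOp u (s.toContinuousLinearMap ∘L tensorVec HA f)
      (s.toContinuousLinearMap ∘L tensorVec HA f') g =
        (inner ℂ f (rightReg g f') : ℂ) • ContinuousLinearMap.id ℂ HA := by
  ext x
  have h1 (v : HA) : opTensor (u.op g) (ContinuousLinearMap.id ℂ H) (s (tensorVec HA f' v)) =
      s (tensorVec HA (rightReg g f') (u.op g v)) := by
    have := congr($(hs g) (tensorVec HA f' v))
    simpa using this
  have h2 (z : HilbertTensor HA (L2 G)) : adjoint s.toContinuousLinearMap (s z) = z := by
    have := (ContinuousLinearMap.norm_map_iff_adjoint_comp_self s.toContinuousLinearMap).1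
      s.norm_map
    exact congr($this z)
  simp [coeffOp, ContinuousLinearMap.adjoint_comp, h1, h2, adjoint_tensorVec_tensorVec]

/-- The Ellwood map has dense range, since the matrix coefficients of the right regular
representation are in the closure of its range and, multiplied by elements of `A`, span a dense
subspace of `C(G, A)`. -/
theorem isFree_of_isometry [T2Space G] (h : IsFaithfulCovariantRep α π u)
    {s : HilbertTensor HA (L2 G) →ₗᵢ[ℂ] HilbertTensor HA H}
    (hs : ∀ X ∈ compactTensor π (L2 G) (L2 G),
      s.toContinuousLinearMap ∘L X ∈ compactTensor π (L2 G) H)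
    (hs' : ∀ g : G, opTensor (u.op g) (ContinuousLinearMap.id ℂ H) ∘L s.toContinuousLinearMap =
      s.toContinuousLinearMap ∘L opTensor (u.op g) (rightReg g)) : α.IsFree := by
  have hclosed : IsClosed (α.ellwoodClosure : Set C(G, A)) :=
    Submodule.isClosed_topologicalClosure _
  have hcoeff (f f' : L2 G) (F : C(G, A))
      (hF : ∀ g, F g = (inner ℂ f (rightReg g f') : ℂ) • (1 : A)) : F ∈ α.ellwoodClosure := by
    refine Metric.mem_closure_iff.2 fun ε hε => ?_
    obtain ⟨z, hz, hzε⟩ := exists_norm_coeffOp_sub_le h (isometry_comp_tensorVec_mem hs f)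
      (isometry_comp_tensorVec_mem hs f') (half_pos hε)
    refine ⟨z, hz, ?_⟩
    rw [dist_eq_norm]
    refine lt_of_le_of_lt ((ContinuousMap.norm_le _ (half_pos hε).le).2 fun g => ?_)
      (half_lt_self hε)
    have e : coeffOp u (s.toContinuousLinearMap ∘L tensorVec HA f)
        (s.toContinuousLinearMap ∘L tensorVec HA f') g = π (F g) := by
      rw [coeffOp_isometry hs', hF, map_smul, map_one]; rfl
    rw [ContinuousMap.sub_apply, ← h.norm_apply, map_sub, ← e]
    exact hzε g
  have htop : α.ellwoodClosure = ⊤ := by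
    refine eq_top_of_mollifier_smul_mem hclosed fun m y a F hF => ?_
    refine hclosed.closure_subset_iff.2 subset_rfl (Metric.mem_closure_iff.2 fun ε hε => ?_)
    have hm := m.continuous
    let T : C(G, C(G, A)) := ContinuousMap.curry
      ⟨fun p : G × G => m (p.2⁻¹ * p.1⁻¹ * y) • a, by fun_prop⟩
    have hT1 : T 1 = F := by ext x; simp [T, hF]
    obtain ⟨k, hk⟩ := exists_mollifier T.continuous (half_pos hε)
    rw [hT1] at hk
    refine ⟨_, ?_, by rw [dist_comm, dist_eq_norm]; exact hk.trans_lt (half_lt_self hε)⟩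
    -- `g ↦ ∫ k(x) m(g⁻¹ x⁻¹ y) dx` is the matrix coefficient `g ↦ ⟪k, r_g m(·⁻¹ y)⟫`.
    let φ : C(G, ℂ) := ⟨fun x => (k x : ℂ), by have := k.continuous; fun_prop⟩
    let ψ : C(G, ℂ) := ⟨fun x => (m (x⁻¹ * y) : ℂ), by fun_prop⟩
    let E : C(G, A) := ⟨fun g => (inner ℂ (toL2 G φ) (rightReg g (toL2 G ψ)) : ℂ) • (1 : A),
      (continuous_const.inner ((rightRep G).continuous_apply _)).smul continuous_const⟩
    have hE := α.const_mul_mem_ellwoodClosure a (hcoeff (toL2 G φ) (toL2 G ψ) E fun g => rfl)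
    suffices heq : ∫ g, k g • T g ∂haarProb G = ContinuousMap.const G a * E by
      rw [heq]; exact hE
    ext g
    rw [ContinuousMap.integral_apply (integrable_haarProb (k.continuous_smul T.continuous))]
    have e1 : E g = (inner ℂ (toL2 G φ) (rightReg g (toL2 G ψ)) : ℂ) • (1 : A) := rfl
    rw [ContinuousMap.mul_apply, e1, rightReg_toL2, inner_toL2, ContinuousMap.const_apply,
      mul_smul_comm, mul_one, ← integral_smul_const]
    congr 1
    funext x
    simp [T, φ, ψ, mul_smul]
    exact smul_comm _ _ _
  rw [CStarDynSystem.IsFree, DenseRange]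
  exact Submodule.dense_iff_topologicalClosure_eq_top.2 htop

end Backward

end FreeAction

end

theorem lemma3p1 {A : Type u} {G : Type v} [CStarAlgebra A]
    [Group G] [TopologicalSpace G] [IsTopologicalGroup G] [CompactSpace G] [T2Space G]
    [MeasurableSpace G] [BorelSpace G] (α : FreeAction.CStarDynSystem A G) :
    α.IsFree ↔
      ∃ (H : Type (max u v w)) (_ : NormedAddCommGroup H) (_ : InnerProductSpace ℂ H)
        (_ : CompleteSpace H) (μ : FreeAction.UnitaryRep G H),
        μ.HasFiniteMultiplicities ∧
        ∀ (HA : Type (max u v w)) [NormedAddCommGroup HA] [InnerProductSpace ℂ HA]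
          [CompleteSpace HA] (π : A →⋆ₐ[ℂ] (HA →L[ℂ] HA)) (u : FreeAction.UnitaryRep G HA),
          FreeAction.IsFaithfulCovariantRep α π u →
          ∃ s : FreeAction.HTensor HA (FreeAction.L2 G) →ₗᵢ[ℂ] FreeAction.HTensor HA H,
            (∀ X ∈ FreeAction.tensorCompact π (FreeAction.L2 G) (FreeAction.L2 G),
              s.toContinuousLinearMap ∘L X ∈ FreeAction.tensorCompact π (FreeAction.L2 G) H) ∧
            (∀ g : G,
              FreeAction.tensorOp (u.op g) (ContinuousLinearMap.id ℂ H) ∘L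
                  s.toContinuousLinearMap =
                s.toContinuousLinearMap ∘L
                  FreeAction.tensorOp (u.op g) (FreeAction.rightReg g)) ∧
            (∀ g : G,
              FreeAction.tensorOp (ContinuousLinearMap.id ℂ HA) (μ.op g) ∘L
                  s.toContinuousLinearMap =
                s.toContinuousLinearMap ∘L
                  FreeAction.tensorOp (ContinuousLinearMap.id ℂ HA)
                    (FreeAction.leftReg g)) := by
  constructor
  · intro h
    obtain ⟨H, i1, i2, i3, μ, hμ, hs⟩ := h.exists_isometry (α := α)
    refine ⟨H, i1, i2, i3, μ, hμ, fun HA j1 j2 j3 π u hπ => ?_⟩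
    obtain ⟨s, hs1, hs2, hs3⟩ := hs HA π u hπ
    refine ⟨s, ?_, ?_, ?_⟩
    · exact hs1
    · exact hs2
    · exact hs3
  · rintro ⟨H, i1, i2, i3, μ, -, hs⟩
    obtain ⟨HA, j1, j2, j3, π, u, h⟩ := FreeAction.exists_isFaithfulCovariantRep.{u, v, w} α
    obtain ⟨s, hs1, hs2, -⟩ := hs HA π u h
    exact FreeAction.isFree_of_isometry h hs1 hs2
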